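/- All graphs are finite and simple. For a graph $G=(V,E)$ let $$\mathbf X_G=\sum_{f}\ \prod_{v\in V}x_{f(v)}$$ be its chromatic symmetric function, where $f$ runs over all proper colorings $f:V\to\mathbb Z_{>0}$ and $x_1,x_2,\dots$ are commuting variables. For a partition $\lambda=(\lambda_1,\dots,\lambda_k)$ of $n$ let $\mathfrak{st}_\lambda=\mathbf X_{St_\lambda}$, where $St_\lambda$ is the disjoint union of star graphs $St_{\lambda_i}$ on $\lambda_i$ vertices. Partitions of $n$, written as weakly decreasing lists of parts, are ordered lexicographically. In a graph, a leaf is a vertex of degree $1$, and a leaf edge is an edge incident to a leaf. An internal edge is an edge both of whose endpoints have degree at least $2$. A deep vertex is a vertex that is neither a leaf nor an endpoint of a leaf edge (so an isolated vertex is deep). **Theorem.** Let $F$ be a forest with $n$ vertices, and let $\lambda_{\mathrm{LC}}(F)$ be the partition of $n$ whose parts are the orders of the connected components of the graph obtained from $F$ by deleting all internal edges of $F$ and keeping all vertices. There are unique coefficients $c_\lambda\in\mathbb Q$ with $\mathbf X_F=\sum_{\lambda\vdash n}c_\lambda\,\mathfrak{st}_\lambda$. The lexicographically smallest partition $\lambda$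 with $c_\lambda\neq0$ is $\lambda_{\mathrm{LC}}(F)$. If $u_1,\dots,u_m$ are the distinct deep vertices of $F$ ($m\ge 0$, an empty product being $1$), then $$c_{\lambda_{\mathrm{LC}}(F)}=(-1)^m\prod_{i=1}^m(\deg(u_i)-1).$$ -/

import Mathlib

/-- The chromatic symmetric function of a finite graph, as a formal power series over `ℚ` in the
commuting variables `x_1, x_2, …`: the coefficient of a monomial `x^d` is the (finite) number of
proper colorings `f : V → ℤ_{>0}` with `∏ v, x_{f v} = x^d`. -/
noncomputable def chromaticSymm {V : Type*} [Fintype V] (G : SimpleGraph V) :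
    MvPowerSeries ℕ+ ℚ :=
  fun d => (Nat.card {f : G.Coloring ℕ+ // ∑ v, Finsupp.single (f v) 1 = d} : ℚ)

/-- The star forest `St_μ`: the disjoint union, over the parts `k` of `μ` (with multiplicity), of
a star on `Fin k` with center `0`. -/
def starForest {n : ℕ} (μ : n.Partition) : SimpleGraph (Σ k : μ.parts, Fin k.1) where
  Adj a b := a ≠ b ∧ a.1 = b.1 ∧ ((a.2 : ℕ) = 0 ∨ (b.2 : ℕ) = 0)
  symm := ⟨fun _ _ h => ⟨h.1.symm, h.2.1.symm, h.2.2.symm⟩⟩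
  loopless := ⟨fun _ h => h.1 rfl⟩

/-- The element `𝔰𝔱_μ` of the star basis. -/
noncomputable def starSymm {n : ℕ} (μ : n.Partition) : MvPowerSeries ℕ+ ℚ :=
  chromaticSymm (starForest μ)

/-- The lexicographic order on the partitions of `n`, each written as the list of its parts in
weakly decreasing order. -/
def lexLE {n : ℕ} (μ ν : n.Partition) : Prop :=
  μ.parts.sort (· ≥ ·) ≤ ν.parts.sort (· ≥ ·)

/-- `μ` is the lexicographically smallest partition of `n` with `c μ ≠ 0`. -/
def IsLeadingPartition {n : ℕ} (c : n.Partition → ℚ) (μ : n.Partition) : Prop :=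
  c μ ≠ 0 ∧ ∀ ν : n.Partition, c ν ≠ 0 → lexLE μ ν

section Graph

variable {V : Type*} [Fintype V] (G : SimpleGraph V)

/-- The partition of `|V|` whose parts are the orders of the connected components of `G`. -/
noncomputable def componentPartition : (Fintype.card V).Partition :=
  letI : Fintype G.ConnectedComponent := Fintype.ofFinite _
  { parts := Finset.univ.val.map fun C : G.ConnectedComponent => C.supp.ncard
    parts_pos := by
      intro i hi
      obtain ⟨C, -, rfl⟩ := Multiset.mem_map.1 hi
      exact (Set.ncard_pos (Set.toFinite _)).2 C.nonempty_supp
    parts_sum := by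
      classical
      change ∑ C : G.ConnectedComponent, C.supp.ncard = _
      rw [← Finset.card_univ, Finset.card_eq_sum_card_fiberwise
        (f := G.connectedComponentMk) (t := Finset.univ) (by simp)]
      refine Finset.sum_congr rfl fun C _ => ?_
      rw [← Set.ncard_coe_finset]
      congr 1
      ext v
      simp }

variable [DecidableRel G.Adj]

/-- A leaf is a vertex of degree `1`. -/
def IsLeaf (v : V) : Prop := G.degree v = 1

/-- The leaf edges: the edges incident to a leaf. -/
def leafEdges : Set (Sym2 V) := {e ∈ G.edgeSet | ∃ v ∈ e, IsLeaf G v}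

/-- The internal edges: the edges both of whose endpoints have degree at least `2`. -/
def internalEdges : Set (Sym2 V) := {e ∈ G.edgeSet | ∀ v ∈ e, 2 ≤ G.degree v}

/-- A deep vertex is a vertex that is not a leaf and not an endpoint of a leaf edge. (An isolated
vertex is deep.) -/
def IsDeep (v : V) : Prop := ¬ IsLeaf G v ∧ ∀ e ∈ leafEdges G, v ∉ e

open Classical in
/-- The finite set of deep vertices. -/
noncomputable def deepVertices : Finset V := Finset.univ.filter (IsDeep G)

/-- The leaf component partition: its parts are the orders of the connected components of the
graph left after deleting all internal edges (and keeping all vertices). -/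
noncomputable def leafComponentPartition : (Fintype.card V).Partition :=
  componentPartition (G.deleteEdges (internalEdges G))

end Graph

/-! The star elements are linearly independent, so one expansion with the right leading term
suffices; it is built by induction on the number of internal edges. A graph with none is a star
forest (`nonempty_iso_starForest`). Otherwise a forest has an internal edge `uv` such that all other
neighbors of `u` are leaves (`IsPendantEdge`). Comparing the colorings with `f u = f v` gives `X_G =
X_{G₁} - X_{G₂} + X_{G₃}`: `G₁` deletes `uv`, `G₂` also hands the leaves of `u` to `v`, and `G₃` is
`G₂` with `uv` put back, so that `u` hangs as a leaf at `v`. All three have fewer internal edges.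

No `Gᵢ` has a leaf component partition smaller than that of `G`, so only those with an equal
partition contribute to the leading coefficient. `G₃` merges the leaf components of `u` and `v` and
never contributes. If `v` has a leaf neighbor, `G₁` keeps the leaf components and the deep degrees,
while `G₂` has a larger partition. If `v` is deep of degree `d`, then `G₂` keeps the partition, with
the isolated vertex `u` (factor `1`) replacing `v`; `G₁` contributes the factor `2 - d`, which is
also right for `d = 2`, where its partition is larger. The total factor is `(2 - d) - 1 = 1 - d`. It
is nonzero since a deep vertex does not have degree `1`, so nothing cancels.

For independence, weighted colors turn a star element into a product of sums, one per part, and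
these sums can take arbitrary values at the sizes `1, …, n`. A linear relation thus becomes a
vanishing polynomial whose monomials are indexed by partitions. -/

/-- The order of the connected component of `x`. -/
noncomputable def compSize {V : Type*} (G : SimpleGraph V) (x : V) : ℕ :=
  {y | G.Reachable x y}.ncard

/-- Reading down from the largest value, the lists agree until the copies of `k` in the first run
out; there the second still has `k`, and the first has a smaller entry or ends. -/
theorem List.lt_of_count_lt {k : ℕ} : ∀ {l₁ l₂ : List ℕ}, l₁.Pairwise (· ≥ ·) →
    l₂.Pairwise (· ≥ ·) → (∀ j, k < j → l₁.count j = l₂.count j) → l₁.count k < l₂.count k →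
    l₁ < l₂
  | _, [], _, _, _, h => by simp at h
  | [], _ :: _, _, _, _, _ => by simp
  | a :: l₁, b :: l₂, h₁, h₂, hgt, hk => by
    rw [List.pairwise_cons] at h₁ h₂
    rw [List.cons_lt_cons_iff]
    rcases lt_trichotomy a b with hab | rfl | hab
    · exact Or.inl hab
    · refine Or.inr ⟨rfl, List.lt_of_count_lt (k := k) h₁.2 h₂.2 (fun j hj => ?_) ?_⟩
      · simpa [List.count_cons] using hgt j hj
      · simpa [List.count_cons] using hk
    · exfalso
      have key : ∀ j, b < j → (b :: l₂).count j = 0 := fun j hj => by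
        rw [List.count_eq_zero, List.mem_cons]
        rintro (h | h)
        · omega
        · exact absurd (h₂.1 j h) (by simpa using hj)
      rcases lt_or_ge k a with hka | hka
      · have := hgt a hka
        rw [key a hab] at this
        simp at this
      · rw [key k (by omega)] at hk
        omega

/-! ### Component orders and the lexicographic order -/

section Components

variable {V : Type*} [Fintype V]

theorem compSize_pos (G : SimpleGraph V) (x : V) : 0 < compSize G x :=
  (Set.ncard_pos (Set.toFinite _)).2 ⟨x, SimpleGraph.Reachable.refl x⟩

omit [Fintype V] in
theorem compSize_eq_ncard_supp (G : SimpleGraph V) (x : V) :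
    compSize G x = (G.connectedComponentMk x).supp.ncard := by
  unfold compSize
  congr 1
  ext y
  simp [SimpleGraph.reachable_comm]

-- Each part `k` accounts for `k` vertices. This trades multiplicities of parts for counts of
-- vertices, so that partitions can be compared vertex by vertex.
open Classical in
theorem count_componentPartition_mul (G : SimpleGraph V) (k : ℕ) :
    (componentPartition G).parts.count k * k
      = (Finset.univ.filter fun x => compSize G x = k).card := by
  let : Fintype G.ConnectedComponent := Fintype.ofFinite _
  have h1 : (componentPartition G).parts.count k
      = (Finset.univ.filter fun C : G.ConnectedComponent => k = C.supp.ncard).card := by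
    change Multiset.count k (Finset.univ.val.map fun C : G.ConnectedComponent => C.supp.ncard) = _
    rw [Multiset.count_map]
    rfl
  rw [h1, Finset.card_eq_sum_card_fiberwise (f := G.connectedComponentMk)
    (t := Finset.univ.filter fun C : G.ConnectedComponent => k = C.supp.ncard), Finset.sum_const_nat]
  · intro C hC
    rw [Finset.mem_filter] at hC
    conv_rhs => rw [hC.2]
    rw [← Set.ncard_coe_finset]
    congr 1
    ext x
    simp only [Finset.coe_filter, Finset.mem_filter, Finset.mem_univ, true_and, Set.mem_ofPred_eq,
      SimpleGraph.ConnectedComponent.mem_supp_iff, compSize_eq_ncard_supp, and_iff_right_iff_imp]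
    rintro rfl
    exact hC.2.symm
  · intro x hx
    simpa [compSize_eq_ncard_supp, eq_comm] using hx

theorem count_zero_parts {n : ℕ} (μ : n.Partition) : μ.parts.count 0 = 0 :=
  Multiset.count_eq_zero.2 fun h => (μ.parts_pos h).ne' rfl

theorem componentPartition_eq_of_compSize_eq {G H : SimpleGraph V} (σ : Equiv.Perm V)
    (h : ∀ x, compSize G x = compSize H (σ x)) : componentPartition G = componentPartition H := by
  classical
  refine Nat.Partition.ext (Multiset.ext.2 fun k => ?_)
  rcases Nat.eq_zero_or_pos k with rfl | hk
  · rw [count_zero_parts, count_zero_parts]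
  · refine Nat.eq_of_mul_eq_mul_right hk ?_
    rw [count_componentPartition_mul, count_componentPartition_mul]
    exact Finset.card_equiv σ fun x => by simp [h]

/-- The order is decided by the largest size whose multiplicities differ. The second alternative
tolerates components that shrink, provided they stay below a size that certainly gains vertices. -/
theorem not_lexLE_of_compSize {G H : SimpleGraph V} {v : V} (hv : compSize G v < compSize H v)
    (h : ∀ x, compSize G x ≤ compSize H x ∨
      compSize G x < compSize H v ∧ compSize H x ≤ compSize H v) :
    ¬ lexLE (componentPartition H) (componentPartition G) := by
  classical
  -- Among the vertices whose component grows, `w` has the largest new component; its order is the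
  -- deciding size.
  obtain ⟨w, hw, hmax⟩ := (Finset.univ.filter fun x => compSize G x < compSize H x).exists_max_image
    (compSize H) ⟨v, by simpa using hv⟩
  simp only [Finset.mem_filter, Finset.mem_univ, true_and] at hw hmax
  have key : ∀ x, compSize G x = compSize H x ∨
      compSize G x < compSize H w ∧ compSize H x ≤ compSize H w := fun x => by
    have := hmax v hv
    rcases h x with h | h
    · rcases h.eq_or_lt with h | h
      · exact Or.inl h
      · exact Or.inr ⟨h.trans_le (hmax x h), hmax x h⟩
    · exact Or.inr ⟨by omega, by omega⟩
  unfold lexLE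
  rw [not_le]
  have hc : ∀ (μ : (Fintype.card V).Partition) (j : ℕ),
      (μ.parts.sort (· ≥ ·)).count j = μ.parts.count j := fun μ j => by
    conv_rhs => rw [← Multiset.sort_eq μ.parts (· ≥ ·), Multiset.coe_count]
  refine List.lt_of_count_lt (k := compSize H w) (Multiset.pairwise_sort _ _)
    (Multiset.pairwise_sort _ _) (fun j hj => ?_) ?_
  · rw [hc, hc]
    refine Nat.eq_of_mul_eq_mul_right (show 0 < j by omega) ?_
    rw [count_componentPartition_mul, count_componentPartition_mul]
    congr 1
    ext x
    have := key x
    simp only [Finset.mem_filter, Finset.mem_univ, true_and]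
    omega
  · rw [hc, hc]
    refine Nat.lt_of_mul_lt_mul_right (a := compSize H w) ?_
    rw [count_componentPartition_mul, count_componentPartition_mul]
    refine Finset.card_lt_card ⟨fun x hx => ?_, fun hsub => ?_⟩
    · have := key x
      simp only [Finset.mem_filter, Finset.mem_univ, true_and] at hx ⊢
      omega
    · have := hsub (show w ∈ _ by simp)
      simp only [Finset.mem_filter, Finset.mem_univ, true_and] at this
      omega

theorem SimpleGraph.Reachable.mem_of_closed {V : Type*} {G : SimpleGraph V} {S : Set V}
    (hS : ∀ a ∈ S, ∀ b, G.Adj a b → b ∈ S) {x y : V} (h : G.Reachable x y) (hx : x ∈ S) : y ∈ S := by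
  obtain ⟨p⟩ := h
  induction p with
  | nil => exact hx
  | cons hadj _ ih => exact ih (hS _ hx _ hadj)

theorem SimpleGraph.Reachable.map_of_adj {V W : Type*} {G : SimpleGraph V} {H : SimpleGraph W}
    {φ : V → W} (hφ : ∀ x y, G.Adj x y → H.Reachable (φ x) (φ y)) {x y : V}
    (h : G.Reachable x y) : H.Reachable (φ x) (φ y) := by
  obtain ⟨p⟩ := h
  induction p with
  | nil => rfl
  | cons hadj _ ih => exact (hφ _ _ hadj).trans ih

theorem compSize_le_of_adj {G H : SimpleGraph V} {φ : V → V} {x : V}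
    (hφ : ∀ x y, G.Adj x y → H.Reachable (φ x) (φ y)) (hinj : Set.InjOn φ {y | G.Reachable x y}) :
    compSize G x ≤ compSize H (φ x) :=
  Set.ncard_le_ncard_of_injOn φ (fun _ hy => SimpleGraph.Reachable.map_of_adj hφ hy) hinj
    (Set.toFinite _)

theorem compSize_lt_of_adj {G H : SimpleGraph V} {φ : V → V} {x z : V}
    (hφ : ∀ x y, G.Adj x y → H.Reachable (φ x) (φ y)) (hinj : Set.InjOn φ {y | G.Reachable x y})
    (hz : H.Reachable (φ x) z) (hne : ∀ y, G.Reachable x y → φ y ≠ z) :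
    compSize G x < compSize H (φ x) := by
  unfold compSize
  rw [← hinj.ncard_image]
  refine Set.ncard_lt_ncard ⟨?_, fun h => ?_⟩ (Set.toFinite _)
  · rintro _ ⟨y, hy, rfl⟩
    exact SimpleGraph.Reachable.map_of_adj hφ hy
  · obtain ⟨y, hy, hyz⟩ := h hz
    exact hne y hy hyz

omit [Fintype V] in
theorem compSize_iso {G H : SimpleGraph V} (σ : G ≃g H) (x : V) :
    compSize G x = compSize H (σ x) := by
  unfold compSize
  rw [← Set.ncard_image_of_injective _ σ.injective]
  congr 1
  ext y
  constructor
  · rintro ⟨y, hy, rfl⟩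
    exact SimpleGraph.Iso.reachable_iff.2 hy
  · intro hy
    exact ⟨σ.symm y, by
      change G.Reachable _ _
      rw [← σ.reachable_iff]; simpa using hy, by simp⟩

theorem componentPartition_eq_of_iso {G H : SimpleGraph V} (σ : G ≃g H) :
    componentPartition G = componentPartition H :=
  componentPartition_eq_of_compSize_eq σ.toEquiv (compSize_iso σ)

theorem not_lexLE_of_coarser {G H : SimpleGraph V} (h : ∀ x y, G.Adj x y → H.Reachable x y)
    {v w : V} (hH : H.Reachable v w) (hG : ¬ G.Reachable v w) :
    ¬ lexLE (componentPartition H) (componentPartition G) := by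
  have h' : ∀ x y, G.Adj x y → H.Reachable (id x) (id y) := h
  refine not_lexLE_of_compSize (v := v)
    (compSize_lt_of_adj h' Function.injective_id.injOn hH fun y hy hyw => hG (hyw ▸ hy))
    fun x => Or.inl (compSize_le_of_adj h' Function.injective_id.injOn)

end Components

/-! ### Specialization to finitely many weighted colors -/

section WeightedColorings

open Classical in
/-- The weighted number of proper colorings of `G` with colors in `K`, a coloring `f` having the
weight `∏ x, w (f x)`. -/
noncomputable def coloringSum {V K : Type*} [Fintype V] [Fintype K] (G : SimpleGraph V)
    (w : K → ℚ) : ℚ :=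
  ∑ f : V → K, if ∀ x y, G.Adj x y → f x ≠ f y then ∏ x, w (f x) else 0

open Classical in
/-- The linear functional which substitutes `w k` for the variable with index `j k`, and `0` for
the variables outside the range of `j`, in the component of degree `n` of a power series. -/
noncomputable def substWeights {K : Type*} [Fintype K] (n : ℕ) (j : K ↪ ℕ+) (w : K → ℚ) :
    MvPowerSeries ℕ+ ℚ →ₗ[ℚ] ℚ :=
  ∑ d ∈ (Finset.univ : Finset K).finsuppAntidiag n,
    (∏ k, w k ^ d k) • MvPowerSeries.coeff (d.mapDomain j)

-- A coloring uses only colors that occur in its monomial, so here it factors through `j`.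
open Classical in
theorem coeff_chromaticSymm_mapDomain {V K : Type*} [Fintype V] [Fintype K] (G : SimpleGraph V)
    (j : K ↪ ℕ+) (d : K →₀ ℕ) :
    MvPowerSeries.coeff (d.mapDomain j) (chromaticSymm G) =
      ((Finset.univ.filter fun f : V → K => (∀ x y, G.Adj x y → f x ≠ f y) ∧
        ∑ v, Finsupp.single (f v) 1 = d).card : ℚ) := by
  have hmap : ∀ f : V → K, (∑ v, Finsupp.single (f v) 1 : K →₀ ℕ).mapDomain j
      = ∑ v, Finsupp.single (j (f v)) 1 := fun f => by
    rw [Finsupp.mapDomain_finsetSum]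
    simp [Finsupp.mapDomain_single]
  change ((Nat.card {f : G.Coloring ℕ+ // ∑ v, Finsupp.single (f v) 1 = d.mapDomain j} : ℕ) : ℚ) = _
  rw [← Fintype.card_subtype, ← Nat.card_eq_fintype_card]
  congr 1
  symm
  refine Nat.card_eq_of_bijective (fun f => ⟨SimpleGraph.Coloring.mk (fun v => j (f.1 v))
    fun {x y} hxy h => f.2.1 x y hxy (j.injective h), ?_⟩) ⟨?_, ?_⟩
  · exact (hmap f.1).symm.trans (congrArg _ f.2.2)
  · intro f g hfg
    ext v
    exact j.injective (DFunLike.congr_fun (congrArg Subtype.val hfg) v)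
  · rintro ⟨g, hg⟩
    have hmem : ∀ v, ∃ k, j k = g v := fun v => by
      have hne : (d.mapDomain j) (g v) ≠ 0 := by
        rw [← hg, Finsupp.finsetSum_apply]
        refine (Finset.sum_pos' (fun _ _ => Nat.zero_le _) ⟨v, Finset.mem_univ v, ?_⟩).ne'
        simp
      by_contra hcon
      exact hne (Finsupp.mapDomain_of_notMem_range _ _ hcon)
    choose f hf using hmem
    refine ⟨⟨f, fun x y hxy h => g.valid hxy ?_, ?_⟩, ?_⟩
    · rw [← hf, ← hf, h]
    · refine Finsupp.mapDomain_injective j.injective ?_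
      rw [hmap, ← hg]
      simp [hf]
    · refine Subtype.ext (DFunLike.ext _ _ hf)

theorem substWeights_chromaticSymm {V K : Type*} [Fintype V] [Fintype K] (G : SimpleGraph V)
    (j : K ↪ ℕ+) (w : K → ℚ) :
    substWeights (Fintype.card V) j w (chromaticSymm G) = coloringSum G w := by
  classical
  unfold substWeights coloringSum
  rw [LinearMap.sum_apply, ← Finset.sum_filter,
    ← Finset.sum_fiberwise_of_maps_to (t := (Finset.univ : Finset K).finsuppAntidiag
      (Fintype.card V)) (g := fun f : V → K => (∑ v, Finsupp.single (f v) 1 : K →₀ ℕ))]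
  · refine Finset.sum_congr rfl fun d _ => ?_
    rw [LinearMap.smul_apply, coeff_chromaticSymm_mapDomain, Finset.filter_filter, smul_eq_mul,
      mul_comm, ← nsmul_eq_mul]
    refine (Finset.sum_eq_card_nsmul fun f hf => ?_).symm
    obtain ⟨-, -, rfl⟩ := Finset.mem_filter.1 hf
    rw [← Finset.prod_fiberwise_of_maps_to (t := Finset.univ) (g := f) (by simp)]
    refine Finset.prod_congr rfl fun k _ => ?_
    rw [Finset.prod_congr rfl (g := fun _ => w k) (by simp +contextual), Finset.prod_const,
      Finsupp.finsetSum_apply, Finset.card_filter]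
    simp [Finsupp.single_apply]
  · intro f _
    rw [Finset.mem_finsuppAntidiag]
    refine ⟨?_, Finset.subset_univ _⟩
    simp only [Finsupp.finsetSum_apply]
    rw [Finset.sum_comm]
    simp [Finsupp.single_apply]

/-- The weighted number of proper colorings of a star on `m` vertices. -/
def starSum {K : Type*} [Fintype K] (w : K → ℚ) (m : ℕ) : ℚ :=
  ∑ c, w c * (∑ b, w b - w c) ^ (m - 1)

-- Once the center has color `c`, each of the `m - 1` leaves independently takes any other color.
open Classical in
theorem sum_star_colorings {K : Type*} [Fintype K] (w : K → ℚ) {m : ℕ} (hm : 0 < m) :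
    ∑ g : Fin m → K, (if ∀ a b : Fin m, a ≠ b → (a : ℕ) = 0 → g a ≠ g b
      then ∏ a, w (g a) else 0) = starSum w m := by
  obtain ⟨r, rfl⟩ : ∃ r, m = r + 1 := ⟨m - 1, by omega⟩
  unfold starSum
  rw [← (Fin.consEquiv fun _ => K).sum_comp, Fintype.sum_prod_type]
  refine Finset.sum_congr rfl fun c _ => ?_
  have h1 : ∑ b, w b - w c = ∑ b, if c ≠ b then w b else 0 := by
    rw [← Finset.sum_filter, ← Finset.sum_filter_add_sum_filter_not Finset.univ (fun b => c ≠ b)]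
    simp [Finset.filter_eq]
  rw [h1, Nat.add_sub_cancel, Fintype.sum_pow, Finset.mul_sum]
  refine Finset.sum_congr rfl fun g _ => ?_
  have h2 : (∀ a b : Fin (r + 1), a ≠ b → (a : ℕ) = 0 →
      Fin.consEquiv (fun _ => K) (c, g) a ≠ Fin.consEquiv (fun _ => K) (c, g) b) ↔
      ∀ i, c ≠ g i := by
    constructor
    · intro h i
      simpa [Fin.consEquiv] using h 0 i.succ (Fin.succ_ne_zero i).symm rfl
    · intro h a b hab ha
      obtain rfl : a = 0 := Fin.ext ha
      obtain ⟨i, rfl⟩ := Fin.exists_succ_eq.2 hab.symm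
      simpa [Fin.consEquiv] using h i
  rw [if_congr h2 rfl rfl, Fin.prod_univ_succ]
  split_ifs with h
  · simp [Fin.consEquiv, h]
  · push Not at h
    obtain ⟨i, hi⟩ := h
    rw [Finset.prod_eq_zero (Finset.mem_univ i), mul_zero]
    simp [hi]

theorem coloringSum_starForest {n : ℕ} (μ : n.Partition) {K : Type*} [Fintype K] (w : K → ℚ) :
    coloringSum (starForest μ) w = (μ.parts.map (starSum w)).prod := by
  classical
  have h1 : (μ.parts.map (starSum w)).prod = ∏ k : μ.parts, starSum w k.1 := by
    rw [Finset.prod_eq_multiset_prod]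
    conv_lhs => rw [← Multiset.map_univ_coe μ.parts]
    rw [Multiset.map_map]
    rfl
  have h2 : ∀ k : μ.parts, starSum w k.1 = _ := fun k =>
    (sum_star_colorings w (μ.parts_pos (Multiset.coe_mem (x := k)))).symm
  rw [h1, Finset.prod_congr rfl fun k _ => h2 k, Fintype.prod_sum]
  unfold coloringSum
  rw [← (Equiv.piCurry fun (k : μ.parts) (_ : Fin k.1) => K).sum_comp]
  refine Finset.sum_congr (Finset.ext fun _ => by simp) fun f _ => ?_
  rw [Finset.prod_ite_zero, ← Fintype.prod_sigma']
  have h3 : (∀ x y, (starForest μ).Adj x y → f x ≠ f y) ↔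
      ∀ k ∈ (Finset.univ : Finset μ.parts), ∀ a b : Fin k.1, a ≠ b → (a : ℕ) = 0 →
        (Equiv.piCurry fun (k : μ.parts) (_ : Fin k.1) => K) f k a ≠
        (Equiv.piCurry fun (k : μ.parts) (_ : Fin k.1) => K) f k b := by
    constructor
    · intro h k _ a b hab ha
      refine h ⟨k, a⟩ ⟨k, b⟩ ⟨fun hh => hab ?_, rfl, Or.inl ha⟩
      simpa using hh
    · rintro h ⟨k, a⟩ ⟨k', b⟩ ⟨hne, hk, hab⟩
      obtain rfl : k = k' := hk
      have hab' : a ≠ b := fun hh => hne (by rw [hh])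
      rcases hab with ha | hb
      · exact h k (Finset.mem_univ _) a b hab' ha
      · exact (h k (Finset.mem_univ _) b a hab'.symm hb).symm
  by_cases h : ∀ x y, (starForest μ).Adj x y → f x ≠ f y
  · rw [if_pos h, if_pos (h3.1 h)]
    rfl
  · rw [if_neg h, if_neg (mt h3.2 h)]

end WeightedColorings

/-! ### Linear independence of the star elements -/

section Independence

open MvPolynomial

theorem card_starForest {n : ℕ} (μ : n.Partition) :
    Fintype.card (Σ k : μ.parts, Fin k.1) = n := by
  rw [Fintype.card_sigma]
  simp only [Fintype.card_fin]
  rw [Finset.sum_eq_multiset_sum, Multiset.map_univ_coe, μ.parts_sum]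

/-- In the unknowns `z i = k i * (i + 1)`, the case `m = 1` says that the total is `s 1`.
Substituting this total makes the system linear, with a Vandermonde matrix on the distinct nodes `s
1 - (i + 1)`. -/
theorem exists_weighted_power_sums (n : ℕ) (s : ℕ → ℚ) :
    ∃ k : Fin n → ℚ, ∀ m, 0 < m → m ≤ n →
      ∑ i, k i * (i + 1) * (∑ j, k j * (j + 1) - (i + 1)) ^ (m - 1) = s m := by
  have hdet : (Matrix.vandermonde fun i : Fin n => s 1 - ((i : ℕ) + 1 : ℚ)).det ≠ 0 := by
    rw [Matrix.det_vandermonde_ne_zero_iff]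
    intro i j hij
    simp only [sub_right_inj, add_left_inj, Nat.cast_inj] at hij
    exact Fin.ext hij
  obtain ⟨z, hz⟩ := Matrix.vecMul_surjective_iff_isUnit.2
    ((Matrix.isUnit_iff_isUnit_det _).2 hdet.isUnit) fun j : Fin n => s (j + 1)
  have hz' : ∀ m, 0 < m → m ≤ n → ∑ i, z i * (s 1 - ((i : ℕ) + 1)) ^ (m - 1) = s m := by
    intro m hm hmn
    have := congrFun hz ⟨m - 1, by omega⟩
    simpa [Matrix.vecMul, dotProduct, Matrix.vandermonde_apply, Nat.sub_add_cancel hm] using this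
  have hk : ∀ i : Fin n, z i / ((i : ℕ) + 1) * ((i : ℕ) + 1 : ℚ) = z i := fun i =>
    div_mul_cancel₀ _ (by positivity)
  refine ⟨fun i => z i / ((i : ℕ) + 1), fun m hm hmn => ?_⟩
  have h1 : ∑ i, z i = s 1 := by simpa using hz' 1 one_pos (hm.trans_le hmn)
  simp only [hk, h1]
  exact hz' m hm hmn

/-- The star sums are polynomial in the numbers `k i` of colors of weight `i + 1`. A relation valid
for all natural `k` therefore holds for rational `k`, where the star sums can be prescribed to be
`s`. -/
theorem starSymm_linearIndependent_aux {n : ℕ} {c : n.Partition → ℚ}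
    (hc : ∑ μ, c μ • starSymm μ = 0) (s : ℕ → ℚ) :
    ∑ μ, c μ * (μ.parts.map s).prod = 0 := by
  classical
  let S : ℕ → MvPolynomial (Fin n) ℚ := fun m =>
    ∑ i : Fin n, X i * C ((i : ℕ) + 1 : ℚ) *
      (∑ j : Fin n, X j * C ((j : ℕ) + 1 : ℚ) - C ((i : ℕ) + 1 : ℚ)) ^ (m - 1)
  have hS : ∀ k : Fin n → ℚ, ∀ m, eval k (S m) =
      ∑ i, k i * (i + 1) * (∑ j, k j * (j + 1) - (i + 1)) ^ (m - 1) := fun k m => by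
    simp only [S, map_sum, map_mul, map_pow, map_sub, eval_X, eval_C]
  have heval : ∀ k : Fin n → ℚ, eval k (∑ μ : n.Partition, C (c μ) * (μ.parts.map S).prod) =
      ∑ μ, c μ * (μ.parts.map fun m => eval k (S m)).prod := fun k => by
    simp [map_multiset_prod, Multiset.map_map]
  have hQ : (∑ μ : n.Partition, C (c μ) * (μ.parts.map S).prod) = 0 := by
    refine funext_set (fun _ => Set.range (Nat.cast : ℕ → ℚ))
      (fun _ => Set.infinite_range_of_injective Nat.cast_injective) fun x hx => ?_
    choose k hk using fun i => hx i (Set.mem_univ i)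
    obtain rfl : (fun i => (k i : ℚ)) = x := funext hk
    rw [heval, map_zero]
    -- There are `k i` colors of weight `i + 1`.
    let w : (Σ i : Fin n, Fin (k i)) → ℚ := fun a => (a.1 : ℕ) + 1
    have hsum : ∀ m, starSum w m = eval (fun i => (k i : ℚ)) (S m) := fun m => by
      rw [hS]
      simp only [starSum, w, Fintype.sum_sigma, Finset.sum_const, Finset.card_univ,
        Fintype.card_fin, nsmul_eq_mul, mul_assoc]
    obtain ⟨j⟩ : Nonempty ((Σ i : Fin n, Fin (k i)) ↪ ℕ+) := by
      exact ⟨(Fintype.equivFin _).toEmbedding.trans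
        (Fin.valEmbedding.trans ⟨Nat.succPNat, Nat.succPNat_injective⟩)⟩
    have := congrArg (substWeights n j w) hc
    rw [map_sum, map_zero] at this
    rw [← this]
    refine Finset.sum_congr rfl fun μ _ => ?_
    have h2 := substWeights_chromaticSymm (starForest μ) j w
    rw [card_starForest] at h2
    rw [map_smul, smul_eq_mul, starSymm, h2, coloringSum_starForest]
    simp only [hsum]
  obtain ⟨k, hk⟩ := exists_weighted_power_sums n s
  have := heval k
  rw [hQ, map_zero] at this
  rw [this]
  refine Finset.sum_congr rfl fun μ _ => ?_
  congr 2
  refine Multiset.map_congr rfl fun m hm => ?_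
  rw [hS, hk m (μ.parts_pos hm)]
  calc m ≤ μ.parts.sum := Multiset.le_sum_of_mem hm
    _ = n := μ.parts_sum

theorem starSymm_linearIndependent (n : ℕ) :
    LinearIndependent ℚ (starSymm : n.Partition → MvPowerSeries ℕ+ ℚ) := by
  classical
  rw [Fintype.linearIndependent_iff]
  intro c hc ν
  -- A polynomial vanishing at every `s` is zero, and distinct partitions give distinct monomials.
  have hR : (∑ μ : n.Partition, monomial (Multiset.toFinsupp μ.parts) (c μ)) = 0 := by
    refine MvPolynomial.funext fun s => ?_
    rw [map_zero, ← starSymm_linearIndependent_aux hc s, map_sum]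
    refine Finset.sum_congr rfl fun μ _ => ?_
    rw [eval_monomial]
    congr 1
    rw [Finsupp.prod, Multiset.toFinsupp_support, Finset.prod_multiset_map_count]
    simp only [Multiset.toFinsupp_apply]
  have := congrArg (coeff (Multiset.toFinsupp ν.parts)) hR
  rw [coeff_sum, coeff_zero, Finset.sum_eq_single ν] at this
  · simpa using this
  · intro μ _ hμ
    rw [coeff_monomial, if_neg]
    intro h
    exact hμ (Nat.Partition.ext (Multiset.toFinsupp.injective h))
  · simp

end Independence

/-! ### Isomorphism invariance and the deletion relation -/

section ChromaticSymm

theorem chromaticSymm_eq_of_iso {V W : Type*} [Fintype V] [Fintype W] {G : SimpleGraph V}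
    {H : SimpleGraph W} (φ : G ≃g H) : chromaticSymm G = chromaticSymm H := by
  funext d
  unfold chromaticSymm
  congr 1
  have hsum : ∀ f : W → ℕ+, ∑ v, Finsupp.single (f (φ v)) 1 = (∑ w, Finsupp.single (f w) 1 : ℕ+ →₀ ℕ) :=
    fun f => φ.toEquiv.sum_comp fun w => Finsupp.single (f w) 1
  symm
  refine Nat.card_eq_of_bijective (fun f => ⟨f.1.comp φ.toHom, (hsum f.1).trans f.2⟩) ⟨?_, ?_⟩
  · intro f g hfg
    refine Subtype.ext (DFunLike.ext _ _ fun w => ?_)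
    have := DFunLike.congr_fun (congrArg Subtype.val hfg) (φ.symm w)
    simpa using this
  · rintro ⟨f, hf⟩
    refine ⟨⟨f.comp φ.symm.toHom, ?_⟩, ?_⟩
    · rw [← hf, ← hsum]
      simp
    · refine Subtype.ext (DFunLike.ext _ _ fun v => ?_)
      simp

variable {V : Type*} [Fintype V]

/-- The proper colorings of `G` with color content `d`. -/
def coloringsOfContent (G : SimpleGraph V) (d : ℕ+ →₀ ℕ) : Set (V → ℕ+) :=
  {f | (∀ x y, G.Adj x y → f x ≠ f y) ∧ ∑ v, Finsupp.single (f v) 1 = d}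

theorem finite_coloringsOfContent (G : SimpleGraph V) (d : ℕ+ →₀ ℕ) :
    (coloringsOfContent G d).Finite := by
  refine (Set.Finite.pi' fun _ : V => d.support.finite_toSet).subset ?_
  rintro f ⟨-, hf⟩ v
  rw [SetLike.mem_coe, Finsupp.mem_support_iff, ← hf, Finsupp.finsetSum_apply]
  refine (Finset.sum_pos' (fun _ _ => Nat.zero_le _) ⟨v, Finset.mem_univ v, ?_⟩).ne'
  simp

theorem chromaticSymm_apply (G : SimpleGraph V) (d : ℕ+ →₀ ℕ) :
    chromaticSymm G d = (coloringsOfContent G d).ncard := by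
  unfold chromaticSymm
  rw [← Nat.card_coe_set_eq]
  congr 1
  refine Nat.card_eq_of_bijective (fun f => ⟨f.1, fun x y h => f.1.valid h, f.2⟩) ⟨?_, ?_⟩
  · intro f g hfg
    exact Subtype.ext (DFunLike.ext _ _ (congrFun (congrArg Subtype.val hfg)))
  · rintro ⟨f, hf⟩
    exact ⟨⟨SimpleGraph.Coloring.mk f fun {x y} h => hf.1 x y h, hf.2⟩, rfl⟩

theorem ncard_coloringsOfContent (G : SimpleGraph V) {u v : V} (huv : u ≠ v) (d : ℕ+ →₀ ℕ) :
    (coloringsOfContent G d).ncard = (coloringsOfContent (G ⊔ SimpleGraph.edge u v) d).ncard +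
      {f ∈ coloringsOfContent G d | f u = f v}.ncard := by
  rw [← Set.ncard_union_eq _ (finite_coloringsOfContent _ _)
    ((finite_coloringsOfContent _ _).subset (Set.sep_subset _ _))]
  · congr 1
    ext f
    simp only [coloringsOfContent, Set.mem_union, Set.mem_ofPred_eq, SimpleGraph.sup_adj,
      SimpleGraph.edge_adj]
    grind
  · rw [Set.disjoint_left]
    rintro f hf ⟨-, h⟩
    exact hf.1 u v (Or.inr (by simp [SimpleGraph.edge_adj, huv])) h

/-- The deletion-near-contraction relation: `G` and `H` have the same proper colorings among those
which do not separate `u` from `v`. -/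
theorem chromaticSymm_sub_sup_edge {G H : SimpleGraph V} {u v : V} (huv : u ≠ v)
    (h : ∀ f : V → ℕ+, f u = f v →
      ((∀ x y, G.Adj x y → f x ≠ f y) ↔ ∀ x y, H.Adj x y → f x ≠ f y)) :
    chromaticSymm (G ⊔ SimpleGraph.edge u v) =
      chromaticSymm G - chromaticSymm H + chromaticSymm (H ⊔ SimpleGraph.edge u v) := by
  funext d
  change _ = chromaticSymm G d - chromaticSymm H d + chromaticSymm (H ⊔ SimpleGraph.edge u v) d
  simp only [chromaticSymm_apply]
  rw [ncard_coloringsOfContent G huv, ncard_coloringsOfContent H huv]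
  have : {f ∈ coloringsOfContent G d | f u = f v} = {f ∈ coloringsOfContent H d | f u = f v} := by
    ext f
    simp only [coloringsOfContent, Set.mem_ofPred_eq]
    constructor
    · rintro ⟨⟨h1, h2⟩, h3⟩
      exact ⟨⟨(h f h3).1 h1, h2⟩, h3⟩
    · rintro ⟨⟨h1, h2⟩, h3⟩
      exact ⟨⟨(h f h3).2 h1, h2⟩, h3⟩
  rw [this]
  push_cast
  ring

end ChromaticSymm

/-! ### Graphs without internal edges are star forests -/

section StarForest

/-- A branching vertex is a vertex with at least two neighbors. -/
def Branches {V : Type*} (G : SimpleGraph V) (x : V) : Prop :=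
  ∃ y z, y ≠ z ∧ G.Adj x y ∧ G.Adj x z

variable {V : Type*} [Fintype V]

-- Take a branching vertex of the component if there is one, and any vertex otherwise. Its neighbors
-- do not branch, so it and its neighbors form a closed set.
omit [Fintype V] in
theorem exists_center {G : SimpleGraph V} (hG : ∀ x y, G.Adj x y → ¬ (Branches G x ∧ Branches G y))
    (C : G.ConnectedComponent) : ∃ c, G.connectedComponentMk c = C ∧
      ∀ x, G.connectedComponentMk x = C → x ≠ c → G.Adj c x ∧ ∀ y, G.Adj x y → y = c := by
  obtain ⟨c, hcC, hc⟩ : ∃ c, G.connectedComponentMk c = C ∧ ∀ z, G.Adj c z → ¬ Branches G z := by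
    by_cases h : ∃ b, G.connectedComponentMk b = C ∧ Branches G b
    · obtain ⟨b, hb, hB⟩ := h
      exact ⟨b, hb, fun z hz hz' => hG b z hz ⟨hB, hz'⟩⟩
    · obtain ⟨x, rfl⟩ := C.exists_rep
      exact ⟨x, rfl, fun z hz hz' => h ⟨z, SimpleGraph.ConnectedComponent.sound hz.symm.reachable, hz'⟩⟩
  have hleaf : ∀ z, G.Adj c z → ∀ w, G.Adj z w → w = c := fun z hz w hw => by
    by_contra hne
    exact hc z hz ⟨w, c, hne, hw, hz.symm⟩
  refine ⟨c, hcC, fun x hx hxc => ?_⟩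
  have hreach : G.Reachable c x := SimpleGraph.ConnectedComponent.exact (hcC.trans hx.symm)
  have hmem := hreach.mem_of_closed (S := {x | x = c ∨ G.Adj c x}) (fun a ha b hab => by
    rcases ha with rfl | ha
    · exact Or.inr hab
    · exact Or.inl (hleaf a ha b hab)) (Or.inl rfl)
  have hadj := hmem.resolve_left hxc
  exact ⟨hadj, hleaf x hadj⟩

theorem exists_equiv_toType {ι : Type*} [Fintype ι] (f : ι → ℕ) :
    ∃ e : ι ≃ (Finset.univ.val.map f : Multiset ℕ), ∀ i, (e i).1 = f i := by
  classical
  let g : ι → (Finset.univ.val : Multiset ι) := fun i =>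
    ⟨i, ⟨0, Multiset.count_pos.2 (Finset.mem_univ_val i)⟩⟩
  have hg : Function.Bijective g := by
    constructor
    · intro i j hij
      exact congrArg Sigma.fst hij
    · rintro ⟨i, m, hm⟩
      have h1 := (Multiset.nodup_iff_count_le_one.1 (Finset.univ : Finset ι).nodup) i
      obtain rfl : m = 0 := by omega
      exact ⟨i, rfl⟩
  exact ⟨(Equiv.ofBijective g hg).trans (Multiset.mapEquiv _ f), fun i =>
    Multiset.mapEquiv_apply _ f (g i)⟩

theorem exists_equiv_fin_apply_eq_zero {α : Type*} [Finite α] {n : ℕ} (h : Nat.card α = n) (a : α) :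
    ∃ e : α ≃ Fin n, ∀ x, (e x : ℕ) = 0 ↔ x = a := by
  classical
  obtain ⟨e⟩ : Nonempty (α ≃ Fin n) := ⟨Finite.equivFinOfCardEq h⟩
  have hn : 0 < n := (e a).pos
  refine ⟨e.trans (Equiv.swap (e a) ⟨0, hn⟩), fun x => ?_⟩
  have h0 : ∀ y : Fin n, (y : ℕ) = 0 ↔ y = ⟨0, hn⟩ := fun y => by rw [Fin.ext_iff]
  rw [h0, Equiv.trans_apply, Equiv.swap_apply_eq_iff, Equiv.swap_apply_right, e.apply_eq_iff_eq]

theorem nonempty_iso_starForest {G : SimpleGraph V}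
    (hG : ∀ x y, G.Adj x y → ¬ (Branches G x ∧ Branches G y)) :
    Nonempty (G ≃g starForest (componentPartition G)) := by
  let : Fintype G.ConnectedComponent := Fintype.ofFinite _
  choose c hcC hc using exists_center hG
  obtain ⟨e, he⟩ : ∃ e : G.ConnectedComponent ≃ (componentPartition G).parts,
      ∀ C, (e C).1 = C.supp.ncard :=
    exists_equiv_toType fun C : G.ConnectedComponent => C.supp.ncard
  have hg : ∀ C : G.ConnectedComponent, ∃ g : {x // G.connectedComponentMk x = C} ≃ Fin (e C).1,
      ∀ x, (g x : ℕ) = 0 ↔ x = ⟨c C, hcC C⟩ := fun C =>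
    exists_equiv_fin_apply_eq_zero (by rw [he]; exact Nat.card_coe_set_eq C.supp) _
  choose g hg using hg
  let ψ : V ≃ Σ k : (componentPartition G).parts, Fin k.1 :=
    (Equiv.sigmaFiberEquiv G.connectedComponentMk).symm.trans (Equiv.sigmaCongr e g)
  have hfst : ∀ x, (ψ x).1 = e (G.connectedComponentMk x) := fun x => rfl
  have hsnd : ∀ x, ((ψ x).2 : ℕ) = 0 ↔ x = c (G.connectedComponentMk x) := fun x => by
    change (g (G.connectedComponentMk x) ⟨x, rfl⟩ : ℕ) = 0 ↔ _
    rw [hg, Subtype.mk.injEq]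
  refine ⟨ψ, fun {x y} => ?_⟩
  change (ψ x ≠ ψ y ∧ (ψ x).1 = (ψ y).1 ∧ (((ψ x).2 : ℕ) = 0 ∨ ((ψ y).2 : ℕ) = 0)) ↔ _
  rw [hsnd, hsnd, hfst, hfst, ψ.injective.ne_iff, e.apply_eq_iff_eq]
  constructor
  · rintro ⟨hne, hC, h⟩
    rcases h with h | h
    · rw [h]
      exact (hc _ y hC.symm fun hy => hne (h.trans hy.symm)).1
    · rw [h]
      exact (hc _ x hC fun hx => hne (hx.trans h.symm)).1.symm
  · intro hxy
    have hC : G.connectedComponentMk x = G.connectedComponentMk y :=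
      SimpleGraph.ConnectedComponent.sound hxy.reachable
    refine ⟨hxy.ne, hC, or_iff_not_imp_left.2 fun hx => ?_⟩
    rw [← hC]
    exact (hc _ x rfl hx).2 y hxy

theorem chromaticSymm_eq_starSymm {G : SimpleGraph V}
    (hG : ∀ x y, G.Adj x y → ¬ (Branches G x ∧ Branches G y)) :
    chromaticSymm G = starSymm (componentPartition G) :=
  chromaticSymm_eq_of_iso (nonempty_iso_starForest hG).some

end StarForest

/-! ### The property of forests used in the induction -/

section Degenerate

variable {V : Type*}

/-- A graph is `1`-degenerate if each nonempty set of vertices contains a vertex with at most one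
neighbor in the set. -/
def IsOneDegenerate (G : SimpleGraph V) : Prop :=
  ∀ W : Set V, W.Nonempty → ∃ w ∈ W, ∀ a ∈ W, ∀ b ∈ W, G.Adj w a → G.Adj w b → a = b

/-- The end of a longest path in the induced forest has no neighbor other than the next vertex of
the path. Degeneracy replaces acyclicity because the surgeries below preserve it by a local
argument. -/
theorem SimpleGraph.IsAcyclic.isOneDegenerate [Finite V] {G : SimpleGraph V} (hG : G.IsAcyclic) :
    IsOneDegenerate G := by
  intro W hW
  have : Nonempty W := hW.to_subtype
  have hA := hG.induce W
  obtain ⟨u, v, p, hp, hmax⟩ := SimpleGraph.Walk.exists_isPath_forall_isPath_length_le_length (G.induce W)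
  have key : ∀ a : W, (G.induce W).Adj u a → a = p.snd := fun a ha => by
    refine hA.eq_snd_of_adj_start hp ha ?_
    by_contra hmem
    have := hmax _ _ _ (hp.cons (h := ha.symm) hmem)
    simp at this
  refine ⟨u, u.2, fun a ha b hb hua hub => ?_⟩
  exact congrArg Subtype.val ((key ⟨a, ha⟩ hua).trans (key ⟨b, hb⟩ hub).symm)

theorem IsOneDegenerate.mono {G H : SimpleGraph V} (hG : IsOneDegenerate G) (h : H ≤ G) :
    IsOneDegenerate H := fun W hW => by
  obtain ⟨w, hw, hwW⟩ := hG W hW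
  exact ⟨w, hw, fun a ha b hb hwa hwb => hwW a ha b hb (h hwa) (h hwb)⟩

end Degenerate

/-! ### Surgery along an internal edge -/

section Surgery

variable {V : Type*}

/-- The graph of the edges of `G` that are not internal. -/
def leafGraph (G : SimpleGraph V) : SimpleGraph V where
  Adj x y := G.Adj x y ∧ ¬ (Branches G x ∧ Branches G y)
  symm := ⟨fun _ _ h => ⟨h.1.symm, fun h' => h.2 h'.symm⟩⟩
  loopless := ⟨fun _ h => h.1.ne rfl⟩

/-- The graph obtained from `G` by deleting the edge `uv`. -/
def cutEdge (G : SimpleGraph V) (u v : V) : SimpleGraph V where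
  Adj x y := G.Adj x y ∧ ¬ (x = u ∧ y = v ∨ x = v ∧ y = u)
  symm := ⟨fun _ _ h => ⟨h.1.symm, fun h' => h.2 (by tauto)⟩⟩
  loopless := ⟨fun _ h => h.1.ne rfl⟩

/-- The graph obtained from `G` by deleting the edge `uv`, attaching to `v` all the other neighbors
of `u`, and leaving `u` isolated. -/
def moveNeighbors (G : SimpleGraph V) (u v : V) : SimpleGraph V where
  Adj x y := (x ≠ u ∧ y ≠ u ∧ G.Adj x y) ∨ (x = v ∧ G.Adj u y ∧ y ≠ v) ∨
    (y = v ∧ G.Adj u x ∧ x ≠ v)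
  symm := ⟨fun _ _ h => by
    rcases h with ⟨h1, h2, h3⟩ | h | h
    · exact Or.inl ⟨h2, h1, h3.symm⟩
    · exact Or.inr (Or.inr h)
    · exact Or.inr (Or.inl h)⟩
  loopless := ⟨fun _ h => by
    rcases h with h | h | h
    · exact h.2.2.ne rfl
    · exact h.2.2 h.1
    · exact h.2.2 h.1⟩

theorem cutEdge_le (G : SimpleGraph V) (u v : V) : cutEdge G u v ≤ G := fun _ _ h => h.1

theorem cutEdge_sup_edge {G : SimpleGraph V} {u v : V} (huv : G.Adj u v) :
    cutEdge G u v ⊔ SimpleGraph.edge u v = G := by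
  ext x y
  have := huv.symm
  simp only [SimpleGraph.sup_adj, SimpleGraph.edge_adj, cutEdge]
  grind [huv.ne]

/-- When `f u = f v`, the constraints imposed by the other edges at `u` can be moved to `v`. -/
theorem chromaticSymm_eq_cutEdge_sub_add [Fintype V] {G : SimpleGraph V} {u v : V}
    (huv : G.Adj u v) : chromaticSymm G = chromaticSymm (cutEdge G u v) -
      chromaticSymm (moveNeighbors G u v) +
      chromaticSymm (moveNeighbors G u v ⊔ SimpleGraph.edge u v) := by
  conv_lhs => rw [← cutEdge_sup_edge huv]
  refine chromaticSymm_sub_sup_edge huv.ne fun f hf => ?_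
  simp only [cutEdge, moveNeighbors]
  constructor
  · rintro h x y (⟨hx, hy, hxy⟩ | ⟨rfl, hy, hne⟩ | ⟨rfl, hx, hne⟩)
    · exact h x y ⟨hxy, by tauto⟩
    · rw [← hf]
      exact h u y ⟨hy, by grind [huv.ne]⟩
    · rw [← hf]
      exact (h u x ⟨hx, by grind [huv.ne]⟩).symm
  · rintro h x y ⟨hxy, hne⟩
    by_cases hx : x = u
    · subst hx
      rw [hf]
      exact h v y (Or.inr (Or.inl ⟨rfl, hxy, by tauto⟩))
    · by_cases hy : y = u
      · subst hy
        rw [hf]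
        exact h x v (Or.inr (Or.inr ⟨rfl, hxy.symm, by tauto⟩))
      · exact h x y (Or.inl ⟨hx, hy, hxy⟩)

/-- The edge `uv` is internal and all the neighbors of `u` other than `v` are leaves. -/
structure IsPendantEdge (G : SimpleGraph V) (u v : V) : Prop where
  adj : G.Adj u v
  exists_left : ∃ x, x ≠ v ∧ G.Adj u x
  exists_right : ∃ w, w ≠ u ∧ G.Adj v w
  eq_of_adj : ∀ x, G.Adj u x → x ≠ v → ∀ y, G.Adj x y → y = u

theorem IsOneDegenerate.exists_isPendantEdge {G : SimpleGraph V} (hG : IsOneDegenerate G)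
    {x y : V} (hxy : G.Adj x y) (hx : Branches G x) (hy : Branches G y) :
    ∃ u v, IsPendantEdge G u v := by
  -- Degeneracy is applied to the endpoints of internal edges: some `u` has only one neighbor `v`
  -- among them.
  obtain ⟨u, ⟨hu, v, huv, hv⟩, h⟩ := hG {x | Branches G x ∧ ∃ y, G.Adj x y ∧ Branches G y}
    ⟨x, hx, y, hxy, hy⟩
  refine ⟨u, v, huv, ?_, ?_, ?_⟩
  · obtain ⟨a, b, hab, ha, hb⟩ := hu
    by_cases hav : a = v
    · exact ⟨b, fun hbv => hab (hav.trans hbv.symm), hb⟩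
    · exact ⟨a, hav, ha⟩
  · obtain ⟨a, b, hab, ha, hb⟩ := hv
    by_cases hau : a = u
    · exact ⟨b, fun hbu => hab (hau.trans hbu.symm), hb⟩
    · exact ⟨a, hau, ha⟩
  · intro x hux hxv y hxy
    by_contra hyu
    exact hxv (h x ⟨⟨y, u, hyu, hxy, hux.symm⟩, u, hux.symm, hu⟩ v ⟨hv, u, huv.symm, hu⟩ hux huv)

namespace IsPendantEdge

variable {G : SimpleGraph V} {u v : V} (h : IsPendantEdge G u v)
include h

theorem branches_left : Branches G u := by
  obtain ⟨x, hx, hux⟩ := h.exists_left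
  exact ⟨x, v, hx, hux, h.adj⟩

theorem branches_right : Branches G v := by
  obtain ⟨x, hx, hux⟩ := h.exists_right
  exact ⟨x, u, hx, hux, h.adj.symm⟩

theorem not_branches {x : V} (hx : G.Adj u x) (hxv : x ≠ v) : ¬ Branches G x := by
  rintro ⟨y, z, hyz, hy, hz⟩
  exact hyz ((h.eq_of_adj x hx hxv y hy).trans (h.eq_of_adj x hx hxv z hz).symm)

omit h in
theorem branches_cutEdge_iff {x : V} (hxu : x ≠ u) (hxv : x ≠ v) :
    Branches (cutEdge G u v) x ↔ Branches G x := by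
  simp only [Branches, cutEdge]
  grind

omit h in
theorem moveNeighbors_adj_iff {x y : V} (hxu : x ≠ u) (hxv : x ≠ v) (hux : ¬ G.Adj u x) :
    (moveNeighbors G u v).Adj x y ↔ G.Adj x y := by
  simp only [moveNeighbors]
  have : G.Adj x y → y ≠ u := fun hxy hy => hux (hy ▸ hxy.symm)
  tauto

theorem moveNeighbors_adj_of_adj_left {x y : V} (hux : G.Adj u x) (hxv : x ≠ v) :
    (moveNeighbors G u v).Adj x y ↔ y = v := by
  simp only [moveNeighbors]
  have := h.eq_of_adj x hux hxv y
  tauto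

theorem moveNeighbors_adj_right {y : V} :
    (moveNeighbors G u v).Adj v y ↔ y ≠ u ∧ G.Adj v y ∨ y ≠ v ∧ G.Adj u y := by
  simp only [moveNeighbors]
  have := h.adj.ne
  have := h.adj.ne'
  tauto

theorem not_moveNeighbors_adj_left {y : V} : ¬ (moveNeighbors G u v).Adj u y := by
  simp only [moveNeighbors]
  have := h.adj.ne
  have : ¬ G.Adj u u := G.irrefl
  tauto

theorem branches_moveNeighbors_iff {x : V} (hxu : x ≠ u) (hxv : x ≠ v) :
    Branches (moveNeighbors G u v) x ↔ Branches G x := by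
  by_cases hux : G.Adj u x
  · refine iff_of_false ?_ (h.not_branches hux hxv)
    rintro ⟨y, z, hyz, hy, hz⟩
    rw [h.moveNeighbors_adj_of_adj_left hux hxv] at hy hz
    exact hyz (hy.trans hz.symm)
  · simp only [Branches, moveNeighbors_adj_iff hxu hxv hux]

theorem branches_moveNeighbors_right : Branches (moveNeighbors G u v) v := by
  obtain ⟨x, hx, hux⟩ := h.exists_left
  obtain ⟨w, hw, hvw⟩ := h.exists_right
  refine ⟨x, w, ?_, h.moveNeighbors_adj_right.2 (Or.inr ⟨hx, hux⟩),
    h.moveNeighbors_adj_right.2 (Or.inl ⟨hw, hvw⟩)⟩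
  rintro rfl
  exact h.adj.ne' (h.eq_of_adj x hux hx v hvw.symm)

theorem not_branches_moveNeighbors_left : ¬ Branches (moveNeighbors G u v) u := by
  rintro ⟨y, z, -, hy, -⟩
  exact h.not_moveNeighbors_adj_left hy

theorem branches_sup_edge_iff {x : V} :
    Branches (moveNeighbors G u v ⊔ SimpleGraph.edge u v) x ↔
      Branches (moveNeighbors G u v) x := by
  have hadj : ∀ x y, (moveNeighbors G u v ⊔ SimpleGraph.edge u v).Adj x y ↔
      (moveNeighbors G u v).Adj x y ∨ x = u ∧ y = v ∨ x = v ∧ y = u := fun x y => by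
    rw [SimpleGraph.sup_adj, SimpleGraph.edge_adj]
    have := h.adj.ne
    grind
  by_cases hxu : x = u
  · subst hxu
    refine iff_of_false ?_ h.not_branches_moveNeighbors_left
    rintro ⟨y, z, hyz, hy, hz⟩
    rw [hadj] at hy hz
    have h1 := h.not_moveNeighbors_adj_left (y := y)
    have h2 := h.not_moveNeighbors_adj_left (y := z)
    have := h.adj.ne
    grind
  · by_cases hxv : x = v
    · subst hxv
      refine iff_of_true ?_ h.branches_moveNeighbors_right
      obtain ⟨y, z, hyz, hy, hz⟩ := h.branches_moveNeighbors_right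
      exact ⟨y, z, hyz, Or.inl hy, Or.inl hz⟩
    · simp only [Branches, hadj, hxu, hxv, false_and, or_false]

/-- If `W` contains `u` or one of its former leaves, that vertex does not branch. Otherwise
adjacency inside `W` already holds in `G`. -/
theorem isOneDegenerate_sup_edge (hG : IsOneDegenerate G) :
    IsOneDegenerate (moveNeighbors G u v ⊔ SimpleGraph.edge u v) := by
  intro W hW
  have hadj : ∀ x y, (moveNeighbors G u v ⊔ SimpleGraph.edge u v).Adj x y ↔
      (moveNeighbors G u v).Adj x y ∨ x = u ∧ y = v ∨ x = v ∧ y = u := fun x y => by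
    rw [SimpleGraph.sup_adj, SimpleGraph.edge_adj]
    have := h.adj.ne
    grind
  have hnb : ∀ w ∈ W, ¬ Branches (moveNeighbors G u v ⊔ SimpleGraph.edge u v) w →
      ∃ w ∈ W, ∀ a ∈ W, ∀ b ∈ W, (moveNeighbors G u v ⊔ SimpleGraph.edge u v).Adj w a →
        (moveNeighbors G u v ⊔ SimpleGraph.edge u v).Adj w b → a = b := fun w hw hB =>
    ⟨w, hw, fun a _ b _ ha hb => by
      by_contra hab
      exact hB ⟨a, b, hab, ha, hb⟩⟩
  by_cases huW : u ∈ W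
  · exact hnb u huW fun hB => h.not_branches_moveNeighbors_left (h.branches_sup_edge_iff.1 hB)
  · by_cases hL : ∃ x ∈ W, G.Adj u x ∧ x ≠ v
    · obtain ⟨x, hxW, hux, hxv⟩ := hL
      exact hnb x hxW fun hB => h.not_branches hux hxv
        ((h.branches_moveNeighbors_iff hux.ne' hxv).1 (h.branches_sup_edge_iff.1 hB))
    · push Not at hL
      obtain ⟨w, hw, hwW⟩ := hG W hW
      have key : ∀ a ∈ W, (moveNeighbors G u v ⊔ SimpleGraph.edge u v).Adj w a → G.Adj w a := by
        intro a ha hwa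
        rw [hadj] at hwa
        simp only [moveNeighbors] at hwa
        grind
      exact ⟨w, hw, fun a ha b hb hwa hwb => hwW a ha b hb (key a ha hwa) (key b hb hwb)⟩

end IsPendantEdge

end Surgery

/-! ### Effect of the surgeries on leaf components -/

namespace IsPendantEdge

variable {V : Type*} {G : SimpleGraph V} {u v : V} (h : IsPendantEdge G u v)
include h

theorem leafGraph_adj_left_iff {y : V} : (leafGraph G).Adj u y ↔ G.Adj u y ∧ y ≠ v := by
  have h1 := h.branches_left
  have h2 := h.branches_right
  constructor
  · rintro ⟨hy, hB⟩
    exact ⟨hy, fun hv => hB ⟨h1, hv ▸ h2⟩⟩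
  · rintro ⟨hy, hv⟩
    exact ⟨hy, fun hB => h.not_branches hy hv hB.2⟩

theorem leafGraph_adj_right_iff {y : V} : (leafGraph G).Adj v y ↔ G.Adj v y ∧ ¬ Branches G y :=
  ⟨fun hy => ⟨hy.1, fun hB => hy.2 ⟨h.branches_right, hB⟩⟩, fun hy => ⟨hy.1, fun hB => hy.2 hB.2⟩⟩

theorem not_leafGraph_adj : ¬ (leafGraph G).Adj u v := fun hadj =>
  hadj.2 ⟨h.branches_left, h.branches_right⟩

theorem eq_or_adj_of_reachable {x : V} (hx : (leafGraph G).Reachable u x) :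
    x = u ∨ G.Adj u x ∧ x ≠ v := by
  refine hx.mem_of_closed (S := {x | x = u ∨ G.Adj u x ∧ x ≠ v}) (fun a ha b hab => ?_) (Or.inl rfl)
  rcases ha with rfl | ⟨ha, hav⟩
  · exact Or.inr (h.leafGraph_adj_left_iff.1 hab)
  · exact Or.inl (h.eq_of_adj a ha hav b hab.1)

theorem not_reachable : ¬ (leafGraph G).Reachable u v := fun hr => by
  rcases h.eq_or_adj_of_reachable hr with hv | hv
  · exact h.adj.ne' hv
  · exact hv.2 rfl

theorem leafGraph_moveNeighbors_adj_right {y : V} : (leafGraph (moveNeighbors G u v)).Adj v y ↔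
    (leafGraph G).Adj v y ∨ (leafGraph G).Adj u y := by
  by_cases hyu : y = u
  · subst hyu
    refine iff_of_false (fun hh => h.not_moveNeighbors_adj_left hh.1.symm) ?_
    rintro (hh | hh)
    · exact h.not_leafGraph_adj hh.symm
    · exact hh.ne rfl
  · by_cases hyv : y = v
    · subst hyv
      refine iff_of_false (fun hh => hh.ne rfl) ?_
      rintro (hh | hh)
      · exact hh.ne rfl
      · exact h.not_leafGraph_adj hh
    · rw [h.leafGraph_adj_left_iff, h.leafGraph_adj_right_iff]
      change (moveNeighbors G u v).Adj v y ∧ ¬ (Branches (moveNeighbors G u v) v ∧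
        Branches (moveNeighbors G u v) y) ↔ _
      rw [h.branches_moveNeighbors_iff hyu hyv, h.moveNeighbors_adj_right]
      have h1 := h.branches_moveNeighbors_right
      have h2 : G.Adj u y → ¬ Branches G y := fun hy => h.not_branches hy hyv
      tauto

theorem leafGraph_moveNeighbors_adj_iff {x y : V} (hxu : x ≠ u) (hxv : x ≠ v) (hyu : y ≠ u)
    (hyv : y ≠ v) : (leafGraph (moveNeighbors G u v)).Adj x y ↔ (leafGraph G).Adj x y := by
  change (moveNeighbors G u v).Adj x y ∧ ¬ (Branches (moveNeighbors G u v) x ∧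
    Branches (moveNeighbors G u v) y) ↔ G.Adj x y ∧ ¬ (Branches G x ∧ Branches G y)
  rw [h.branches_moveNeighbors_iff hyu hyv, h.branches_moveNeighbors_iff hxu hxv]
  simp only [moveNeighbors]
  tauto

theorem not_leafGraph_moveNeighbors_adj_left {y : V} :
    ¬ (leafGraph (moveNeighbors G u v)).Adj u y := fun hh => h.not_moveNeighbors_adj_left hh.1

theorem leafGraph_moveNeighbors_le :
    leafGraph (moveNeighbors G u v) ≤
      leafGraph (moveNeighbors G u v ⊔ SimpleGraph.edge u v) := fun x y hxy => by
  refine ⟨Or.inl hxy.1, ?_⟩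
  rw [h.branches_sup_edge_iff, h.branches_sup_edge_iff]
  exact hxy.2

theorem leafGraph_sup_edge_adj :
    (leafGraph (moveNeighbors G u v ⊔ SimpleGraph.edge u v)).Adj u v := by
  refine ⟨Or.inr (by simp [SimpleGraph.edge_adj, h.adj.ne]), ?_⟩
  rw [h.branches_sup_edge_iff]
  exact fun hB => h.not_branches_moveNeighbors_left hB.1

/-- Only `u` and `v` lose a neighbor. Whether `u` still branches is irrelevant, its other neighbors
being leaves; and `v` still branches whenever it has another branching neighbor. -/
theorem leafGraph_cutEdge (hv : (∃ x, G.Adj v x ∧ ¬ Branches G x) ∨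
    ∃ a b, a ≠ b ∧ a ≠ u ∧ b ≠ u ∧ G.Adj v a ∧ G.Adj v b) :
    leafGraph (cutEdge G u v) = leafGraph G := by
  have hB : ∀ x, Branches (cutEdge G u v) x → Branches G x := fun x ⟨y, z, hyz, hy, hz⟩ =>
    ⟨y, z, hyz, hy.1, hz.1⟩
  have hBv : ∀ y, G.Adj v y → y ≠ u → Branches G y → Branches (cutEdge G u v) v := by
    intro y hy hyu hyB
    have hne := h.adj.ne'
    rcases hv with ⟨x, hx, hxB⟩ | ⟨a, b, hab, ha, hb, hva, hvb⟩
    · have hxu : x ≠ u := fun hxu => hxB (hxu ▸ h.branches_left)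
      exact ⟨x, y, fun hxy => hxB (hxy ▸ hyB), ⟨hx, by tauto⟩, ⟨hy, by tauto⟩⟩
    · exact ⟨a, b, hab, ⟨hva, by tauto⟩, ⟨hvb, by tauto⟩⟩
  have hBx : ∀ x y, G.Adj x y → Branches G x → Branches G y →
      ¬ (x = u ∧ y = v ∨ x = v ∧ y = u) → Branches (cutEdge G u v) x := by
    intro x y hxy hx hy hne
    by_cases hxu : x = u
    · subst hxu
      exact absurd hy (h.not_branches hxy fun hyv => hne (Or.inl ⟨rfl, hyv⟩))
    · by_cases hxv : x = v
      · subst hxv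
        exact hBv y hxy (by tauto) hy
      · exact (branches_cutEdge_iff hxu hxv).2 hx
  ext x y
  constructor
  · rintro ⟨hxy, hn⟩
    refine ⟨hxy.1, fun ⟨hx, hy⟩ => hn ⟨hBx x y hxy.1 hx hy hxy.2, hBx y x hxy.1.symm hy hx ?_⟩⟩
    have := hxy.2
    tauto
  · rintro ⟨hxy, hn⟩
    refine ⟨⟨hxy, ?_⟩, fun hh => hn ⟨hB x hh.1, hB y hh.2⟩⟩
    rintro (⟨rfl, rfl⟩ | ⟨rfl, rfl⟩)
    · exact hn ⟨h.branches_left, h.branches_right⟩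
    · exact hn ⟨h.branches_right, h.branches_left⟩

variable [Fintype V]

/-- Here `v` has degree `2`, so cutting `uv` makes it a leaf and its remaining edge enters the leaf
graph. -/
theorem not_lexLE_cutEdge (hleaf : ∀ x, G.Adj v x → Branches G x)
    (htwo : ∀ a b, a ≠ u → b ≠ u → G.Adj v a → G.Adj v b → a = b) :
    ¬ lexLE (componentPartition (leafGraph (cutEdge G u v)))
      (componentPartition (leafGraph G)) := by
  obtain ⟨w, hwu, hvw⟩ := h.exists_right
  refine not_lexLE_of_coarser (v := v) (w := w) (fun x y hxy => SimpleGraph.Adj.reachable ?_)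
    (SimpleGraph.Adj.reachable ?_) fun hr => ?_
  · refine ⟨⟨hxy.1, ?_⟩, fun ⟨⟨a, b, hab, ha, hb⟩, ⟨c, d, hcd, hc, hd⟩⟩ =>
      hxy.2 ⟨⟨a, b, hab, ha.1, hb.1⟩, ⟨c, d, hcd, hc.1, hd.1⟩⟩⟩
    rintro (⟨rfl, rfl⟩ | ⟨rfl, rfl⟩)
    · exact h.not_leafGraph_adj hxy
    · exact h.not_leafGraph_adj hxy.symm
  · refine ⟨⟨hvw, ?_⟩, ?_⟩
    · have := h.adj.ne'
      tauto
    · rintro ⟨⟨a, b, hab, ha, hb⟩, -⟩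
      exact hab (htwo a b (fun hau => ha.2 (Or.inr ⟨rfl, hau⟩))
        (fun hbu => hb.2 (Or.inr ⟨rfl, hbu⟩)) ha.1 hb.1)
  · have := hr.mem_of_closed (S := {v}) (fun a ha b hab => by
      obtain rfl : a = v := ha
      exact absurd (hleaf b hab.1) (h.leafGraph_adj_right_iff.1 hab).2) rfl
    exact hvw.ne' this

theorem not_lexLE_sup_edge :
    ¬ lexLE (componentPartition (leafGraph (moveNeighbors G u v ⊔ SimpleGraph.edge u v)))
      (componentPartition (leafGraph G)) := by
  have hleft : ∀ y, (leafGraph G).Adj u y →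
      (leafGraph (moveNeighbors G u v ⊔ SimpleGraph.edge u v)).Reachable u y := fun y hy =>
    h.leafGraph_sup_edge_adj.reachable.trans (SimpleGraph.Adj.reachable
      (h.leafGraph_moveNeighbors_le (h.leafGraph_moveNeighbors_adj_right.2 (Or.inr hy))))
  have hright : ∀ y, (leafGraph G).Adj v y →
      (leafGraph (moveNeighbors G u v ⊔ SimpleGraph.edge u v)).Reachable v y := fun y hy =>
    SimpleGraph.Adj.reachable
      (h.leafGraph_moveNeighbors_le (h.leafGraph_moveNeighbors_adj_right.2 (Or.inl hy)))
  refine not_lexLE_of_coarser (v := u) (w := v) (fun x y hxy => ?_)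
    h.leafGraph_sup_edge_adj.reachable h.not_reachable
  by_cases hxu : x = u
  · exact hxu ▸ hleft y (hxu ▸ hxy)
  by_cases hyu : y = u
  · exact hyu ▸ (hleft x (hyu ▸ hxy.symm)).symm
  by_cases hxv : x = v
  · exact hxv ▸ hright y (hxv ▸ hxy)
  by_cases hyv : y = v
  · exact hyv ▸ (hright x (hyv ▸ hxy.symm)).symm
  exact SimpleGraph.Adj.reachable (h.leafGraph_moveNeighbors_le
    ((h.leafGraph_moveNeighbors_adj_iff hxu hxv hyu hyv).2 hxy))

theorem not_lexLE_moveNeighbors {z : V} (hvz : G.Adj v z) (hz : ¬ Branches G z) :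
    ¬ lexLE (componentPartition (leafGraph (moveNeighbors G u v)))
      (componentPartition (leafGraph G)) := by
  classical
  -- Sending `u` to `v` carries leaf edges to leaf edges, and is injective on each leaf component
  -- because `u` and `v` lie in different ones.
  let φ : V → V := fun x => if x = u then v else x
  have hφu : φ u = v := if_pos rfl
  have hφ : ∀ x, x ≠ u → φ x = x := fun x hx => if_neg hx
  have hφv : φ v = v := hφ v h.adj.ne'
  have hmap1 : ∀ y, (leafGraph G).Adj u y → (leafGraph (moveNeighbors G u v)).Adj v (φ y) :=
    fun y hy => by
      rw [hφ y hy.ne']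
      exact h.leafGraph_moveNeighbors_adj_right.2 (Or.inr hy)
  have hmap2 : ∀ y, y ≠ u → (leafGraph G).Adj v y →
      (leafGraph (moveNeighbors G u v)).Adj v (φ y) := fun y hyu hy => by
    rw [hφ y hyu]
    exact h.leafGraph_moveNeighbors_adj_right.2 (Or.inl hy)
  have hmap : ∀ x y, (leafGraph G).Adj x y →
      (leafGraph (moveNeighbors G u v)).Reachable (φ x) (φ y) := by
    intro x y hxy
    refine SimpleGraph.Adj.reachable ?_
    by_cases hxu : x = u
    · subst hxu
      rw [hφu]
      exact hmap1 y hxy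
    by_cases hyu : y = u
    · subst hyu
      rw [hφu]
      exact (hmap1 x hxy.symm).symm
    by_cases hxv : x = v
    · subst hxv
      rw [hφv]
      exact hmap2 y hyu hxy
    by_cases hyv : y = v
    · subst hyv
      rw [hφv]
      exact (hmap2 x hxu hxy.symm).symm
    rw [hφ x hxu, hφ y hyu]
    exact (h.leafGraph_moveNeighbors_adj_iff hxu hxv hyu hyv).2 hxy
  have hinj : ∀ x, Set.InjOn φ {y | (leafGraph G).Reachable x y} := by
    intro x a ha b hb hab
    by_cases hau : a = u
    · by_cases hbu : b = u
      · rw [hau, hbu]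
      · rw [hau, hφu, hφ b hbu] at hab
        exact absurd ((hau ▸ ha).symm.trans (hab ▸ hb)) h.not_reachable
    · by_cases hbu : b = u
      · rw [hbu, hφu, hφ a hau] at hab
        exact absurd ((hbu ▸ hb).symm.trans (hab ▸ ha)) h.not_reachable
      · rwa [hφ a hau, hφ b hbu] at hab
  obtain ⟨x₀, hx₀v, hux₀⟩ := h.exists_left
  have hux₀' := h.leafGraph_adj_left_iff.2 ⟨hux₀, hx₀v⟩
  have hlt : compSize (leafGraph G) v < compSize (leafGraph (moveNeighbors G u v)) v := by
    have := compSize_lt_of_adj hmap (hinj v) (z := x₀) (by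
      rw [hφv]
      exact (h.leafGraph_moveNeighbors_adj_right.2 (Or.inr hux₀')).reachable) fun y hy hyx => by
        by_cases hyu : y = u
        · rw [hyu, hφu] at hyx
          exact hx₀v hyx.symm
        · rw [hφ y hyu] at hyx
          exact h.not_reachable (hux₀'.reachable.trans (hyx ▸ hy).symm)
    rwa [hφv] at this
  -- The leaf `z` of `v` is not in the image of the component of `u`, which makes the inequality
  -- strict.
  have hlt' : compSize (leafGraph G) u < compSize (leafGraph (moveNeighbors G u v)) v := by
    have := compSize_lt_of_adj hmap (hinj u) (z := z) (by
      rw [hφu]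
      exact (h.leafGraph_moveNeighbors_adj_right.2
        (Or.inl (h.leafGraph_adj_right_iff.2 ⟨hvz, hz⟩))).reachable) fun y hy hyz => by
        by_cases hyu : y = u
        · rw [hyu, hφu] at hyz
          exact hvz.ne hyz
        · rw [hφ y hyu] at hyz
          rcases h.eq_or_adj_of_reachable hy with h1 | ⟨h1, h2⟩
          · exact hyu h1
          · exact h.adj.ne' (h.eq_of_adj y h1 h2 v (hyz ▸ hvz.symm))
    rwa [hφu] at this
  -- Only `u` can lose, becoming isolated; its old component is smaller than the new component of
  -- `v`.
  refine not_lexLE_of_compSize hlt fun x => ?_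
  by_cases hxu : x = u
  · subst hxu
    refine Or.inr ⟨hlt', ?_⟩
    have hsub : {y | (leafGraph (moveNeighbors G x v)).Reachable x y} ⊆ {x} := fun y hy =>
      SimpleGraph.Reachable.mem_of_closed (S := {x}) (fun a ha b hab => by
        obtain rfl : a = x := ha
        exact absurd hab h.not_leafGraph_moveNeighbors_adj_left) hy rfl
    have h1 := Set.ncard_le_ncard hsub
    rw [Set.ncard_singleton] at h1
    exact h1.trans (compSize_pos _ _)
  · have := compSize_le_of_adj hmap (hinj x)
    rw [hφ x hxu] at this
    exact Or.inl this

/-- Since `v` is isolated in the leaf graph, the surgery merely exchanges the roles of `u` and `v`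
there. -/
theorem componentPartition_moveNeighbors (hleaf : ∀ x, G.Adj v x → Branches G x) :
    componentPartition (leafGraph (moveNeighbors G u v)) = componentPartition (leafGraph G) := by
  classical
  have hv : ∀ y, ¬ (leafGraph G).Adj v y := fun y hy =>
    (h.leafGraph_adj_right_iff.1 hy).2 (hleaf y hy.1)
  have hright : ∀ y, (leafGraph (moveNeighbors G u v)).Adj v y ↔ (leafGraph G).Adj u y := fun y => by
    rw [h.leafGraph_moveNeighbors_adj_right]
    have := hv y
    tauto
  have hleft : ∀ y, ¬ (leafGraph (moveNeighbors G u v)).Adj u y := fun y =>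
    h.not_leafGraph_moveNeighbors_adj_left
  have key : ∀ x y, (leafGraph G).Adj (Equiv.swap u v x) (Equiv.swap u v y) ↔
      (leafGraph (moveNeighbors G u v)).Adj x y := by
    intro x y
    by_cases hxu : x = u
    · subst hxu
      rw [Equiv.swap_apply_left]
      exact iff_of_false (hv _) (hleft _)
    by_cases hyu : y = u
    · subst hyu
      rw [Equiv.swap_apply_left, SimpleGraph.adj_comm, SimpleGraph.adj_comm _ x]
      exact iff_of_false (hv _) (hleft _)
    by_cases hxv : x = v
    · subst hxv
      by_cases hyx : y = x
      · subst hyx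
        exact iff_of_false (fun hh => hh.ne rfl) (fun hh => hh.ne rfl)
      · rw [Equiv.swap_apply_right, Equiv.swap_apply_of_ne_of_ne hyu hyx, hright]
    by_cases hyv : y = v
    · subst hyv
      rw [Equiv.swap_apply_right, Equiv.swap_apply_of_ne_of_ne hxu hxv, SimpleGraph.adj_comm,
        SimpleGraph.adj_comm _ x, hright]
    rw [Equiv.swap_apply_of_ne_of_ne hxu hxv, Equiv.swap_apply_of_ne_of_ne hyu hyv,
      h.leafGraph_moveNeighbors_adj_iff hxu hxv hyu hyv]
  exact componentPartition_eq_of_iso ⟨Equiv.swap u v, fun {x y} => key x y⟩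

end IsPendantEdge

/-! ### The leading coefficient and the induction -/

section LeadingTerm

variable {V : Type*} [Fintype V]

open Classical in
/-- The finite set of isolated vertices of `G`. -/
noncomputable def isolatedVertices (G : SimpleGraph V) : Finset V :=
  Finset.univ.filter fun x => ∀ y, ¬ G.Adj x y

theorem mem_isolatedVertices {G : SimpleGraph V} {x : V} :
    x ∈ isolatedVertices G ↔ ∀ y, ¬ G.Adj x y := by
  simp [isolatedVertices]

/-- The product of `1 - deg x` over the deep vertices `x`. -/
noncomputable def deepProd (G : SimpleGraph V) : ℚ :=
  ∏ x ∈ isolatedVertices (leafGraph G), (1 - ((G.neighborSet x).ncard : ℚ))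

/-- A vanishing factor would need degree `1`, but the only edge at such a vertex is a leaf edge. -/
theorem deepProd_ne_zero (G : SimpleGraph V) : deepProd G ≠ 0 := by
  refine Finset.prod_ne_zero_iff.2 fun x hx h0 => ?_
  rw [mem_isolatedVertices] at hx
  have h1 : (G.neighborSet x).ncard = 1 := by
    have : ((G.neighborSet x).ncard : ℚ) = 1 := by linarith
    exact_mod_cast this
  obtain ⟨y, hy⟩ := Set.ncard_eq_one.1 h1
  have hxy : G.Adj x y := by
    have : y ∈ G.neighborSet x := hy ▸ rfl
    exact this
  refine hx y ⟨hxy, ?_⟩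
  rintro ⟨⟨a, b, hab, ha, hb⟩, -⟩
  have ha' : a ∈ G.neighborSet x := ha
  have hb' : b ∈ G.neighborSet x := hb
  rw [hy] at ha' hb'
  exact hab (ha'.trans hb'.symm)

theorem deepProd_eq_one {G : SimpleGraph V}
    (hG : ∀ x y, G.Adj x y → ¬ (Branches G x ∧ Branches G y)) : deepProd G = 1 := by
  refine Finset.prod_eq_one fun x hx => ?_
  rw [mem_isolatedVertices] at hx
  have : G.neighborSet x = ∅ := Set.eq_empty_of_forall_notMem fun y hy => hx y ⟨hy, hG x y hy⟩
  simp [this]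

namespace IsPendantEdge

variable {G : SimpleGraph V} {u v : V}

omit [Fintype V] in
theorem neighborSet_cutEdge {x : V} (hxu : x ≠ u) (hxv : x ≠ v) :
    (cutEdge G u v).neighborSet x = G.neighborSet x := by
  ext y
  simp only [SimpleGraph.mem_neighborSet, cutEdge]
  tauto

variable (h : IsPendantEdge G u v)
include h

theorem ncard_neighborSet_cutEdge :
    ((cutEdge G u v).neighborSet v).ncard + 1 = (G.neighborSet v).ncard := by
  have : (cutEdge G u v).neighborSet v = G.neighborSet v \ {u} := by
    ext y
    have := h.adj.ne
    simp only [SimpleGraph.mem_neighborSet, cutEdge, Set.mem_sdiff, Set.mem_singleton_iff]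
    tauto
  rw [this]
  exact Set.ncard_sdiff_singleton_add_one (s := G.neighborSet v) h.adj.symm

theorem left_notMem_isolatedVertices : u ∉ isolatedVertices (leafGraph G) := fun hu => by
  obtain ⟨x, hxv, hux⟩ := h.exists_left
  exact mem_isolatedVertices.1 hu x (h.leafGraph_adj_left_iff.2 ⟨hux, hxv⟩)

theorem deepProd_cutEdge {z : V} (hvz : G.Adj v z) (hz : ¬ Branches G z) :
    deepProd (cutEdge G u v) = deepProd G := by
  unfold deepProd
  rw [h.leafGraph_cutEdge (Or.inl ⟨z, hvz, hz⟩)]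
  refine Finset.prod_congr rfl fun x hx => ?_
  rw [neighborSet_cutEdge]
  · rintro rfl
    exact h.left_notMem_isolatedVertices hx
  · rintro rfl
    exact mem_isolatedVertices.1 hx z (h.leafGraph_adj_right_iff.2 ⟨hvz, hz⟩)

variable (hleaf : ∀ x, G.Adj v x → Branches G x)
include hleaf

theorem right_mem_isolatedVertices : v ∈ isolatedVertices (leafGraph G) :=
  mem_isolatedVertices.2 fun y hy => (h.leafGraph_adj_right_iff.1 hy).2 (hleaf y hy.1)

open Classical in
theorem deepProd_eq_mul : deepProd G = (1 - ((G.neighborSet v).ncard : ℚ)) *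
    ∏ x ∈ (isolatedVertices (leafGraph G)).erase v, (1 - ((G.neighborSet x).ncard : ℚ)) :=
  (Finset.mul_prod_erase _ _ (h.right_mem_isolatedVertices hleaf)).symm

open Classical in
theorem deepProd_cutEdge_eq_mul {a b : V} (hab : a ≠ b) (hau : a ≠ u) (hbu : b ≠ u)
    (hva : G.Adj v a) (hvb : G.Adj v b) :
    deepProd (cutEdge G u v) = (2 - ((G.neighborSet v).ncard : ℚ)) *
      ∏ x ∈ (isolatedVertices (leafGraph G)).erase v, (1 - ((G.neighborSet x).ncard : ℚ)) := by
  unfold deepProd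
  rw [h.leafGraph_cutEdge (Or.inr ⟨a, b, hab, hau, hbu, hva, hvb⟩),
    ← Finset.mul_prod_erase _ _ (h.right_mem_isolatedVertices hleaf),
    ← h.ncard_neighborSet_cutEdge]
  congr 1
  · push_cast
    ring
  · refine Finset.prod_congr rfl fun x hx => ?_
    obtain ⟨hxv, hx⟩ := Finset.mem_erase.1 hx
    rw [neighborSet_cutEdge _ hxv]
    rintro rfl
    exact h.left_notMem_isolatedVertices hx

-- The vertex `u`, now isolated with factor `1`, replaces `v` among the deep vertices; the other
-- factors are unchanged.
open Classical in
theorem deepProd_moveNeighbors : deepProd (moveNeighbors G u v) =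
    ∏ x ∈ (isolatedVertices (leafGraph G)).erase v, (1 - ((G.neighborSet x).ncard : ℚ)) := by
  have hset : isolatedVertices (leafGraph (moveNeighbors G u v)) =
      insert u ((isolatedVertices (leafGraph G)).erase v) := by
    obtain ⟨x₀, hx₀v, hux₀⟩ := h.exists_left
    have hux₀' := h.leafGraph_adj_left_iff.2 ⟨hux₀, hx₀v⟩
    ext x
    rw [Finset.mem_insert, Finset.mem_erase, mem_isolatedVertices, mem_isolatedVertices]
    by_cases hxu : x = u
    · subst hxu
      exact iff_of_true (fun y => h.not_leafGraph_moveNeighbors_adj_left) (Or.inl rfl)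
    by_cases hxv : x = v
    · subst hxv
      refine iff_of_false (fun hx => hx x₀ (h.leafGraph_moveNeighbors_adj_right.2 (Or.inr hux₀'))) ?_
      simp [hxu]
    simp only [hxu, hxv, false_or, ne_eq, not_false_eq_true, true_and]
    have hvx : ¬ (leafGraph G).Adj v x := fun hx =>
      (h.leafGraph_adj_right_iff.1 hx).2 (hleaf x hx.1)
    constructor
    · intro hx y hxy
      by_cases hyu : y = u
      · subst hyu
        exact hx v (h.leafGraph_moveNeighbors_adj_right.2 (Or.inr hxy.symm)).symm
      by_cases hyv : y = v
      · subst hyv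
        exact hvx hxy.symm
      exact hx y ((h.leafGraph_moveNeighbors_adj_iff hxu hxv hyu hyv).2 hxy)
    · intro hx y hxy
      by_cases hyu : y = u
      · subst hyu
        exact h.not_leafGraph_moveNeighbors_adj_left hxy.symm
      by_cases hyv : y = v
      · subst hyv
        rcases h.leafGraph_moveNeighbors_adj_right.1 hxy.symm with h1 | h1
        · exact hvx h1
        · exact hx u h1.symm
      exact hx y ((h.leafGraph_moveNeighbors_adj_iff hxu hxv hyu hyv).1 hxy)
  have hu : (moveNeighbors G u v).neighborSet u = ∅ :=
    Set.eq_empty_of_forall_notMem fun y => h.not_moveNeighbors_adj_left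
  unfold deepProd
  rw [hset, Finset.prod_insert fun hu =>
    h.left_notMem_isolatedVertices (Finset.mem_of_mem_erase hu), hu]
  simp only [Set.ncard_empty, Nat.cast_zero, sub_zero, one_mul]
  refine Finset.prod_congr rfl fun x hx => ?_
  obtain ⟨hxv, hx⟩ := Finset.mem_erase.1 hx
  have hxu : x ≠ u := fun hxu => h.left_notMem_isolatedVertices (hxu ▸ hx)
  have hux : ¬ G.Adj u x := fun hux =>
    mem_isolatedVertices.1 hx u (h.leafGraph_adj_left_iff.2 ⟨hux, hxv⟩).symm
  congr 3
  ext y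
  exact moveNeighbors_adj_iff hxu hxv hux

end IsPendantEdge

/-- The leading term of the expansion of the chromatic symmetric function of `G` in the star
basis is the one predicted by the leaf components and the deep vertices. -/
def HasLeafLeadingTerm (G : SimpleGraph V) : Prop :=
  ∃ c : (Fintype.card V).Partition → ℚ, chromaticSymm G = ∑ μ, c μ • starSymm μ ∧
    IsLeadingPartition c (componentPartition (leafGraph G)) ∧
    c (componentPartition (leafGraph G)) = deepProd G

theorem lexLE_refl {n : ℕ} (μ : n.Partition) : lexLE μ μ := le_refl (μ.parts.sort (· ≥ ·))

theorem lexLE_trans {n : ℕ} {μ ν ρ : n.Partition} (h₁ : lexLE μ ν) (h₂ : lexLE ν ρ) : lexLE μ ρ :=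
  le_trans (α := List ℕ) h₁ h₂

theorem lexLE_of_not_lexLE {n : ℕ} {μ ν : n.Partition} (h : ¬ lexLE μ ν) : lexLE ν μ :=
  (le_total (α := List ℕ) _ _).resolve_left h

theorem hasLeafLeadingTerm_of_not_branches {G : SimpleGraph V}
    (hG : ∀ x y, G.Adj x y → ¬ (Branches G x ∧ Branches G y)) : HasLeafLeadingTerm G := by
  classical
  have hL : leafGraph G = G := by
    ext x y
    exact ⟨fun h => h.1, fun h => ⟨h, hG x y h⟩⟩
  refine ⟨fun μ => if μ = componentPartition G then 1 else 0, ?_, ?_, ?_⟩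
  · rw [chromaticSymm_eq_starSymm hG]
    simp
  · rw [hL]
    refine ⟨by simp, fun ν hν => ?_⟩
    obtain rfl : ν = componentPartition G := by
      by_contra hne
      exact hν (if_neg hne)
    exact lexLE_refl _
  · rw [hL, deepProd_eq_one hG]
    exact if_pos rfl

/-- Here `a₁` and `a₂` are the coefficients of `G₁` and `G₂` at the partition of `G`, zero when
their own leading partition is larger. Nonvanishing of `deepProd G` rules out cancellation. -/
theorem HasLeafLeadingTerm.combine {G G₁ G₂ G₃ : SimpleGraph V} {a₁ a₂ : ℚ}
    (h₁ : HasLeafLeadingTerm G₁) (h₂ : HasLeafLeadingTerm G₂) (h₃ : HasLeafLeadingTerm G₃)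
    (hX : chromaticSymm G = chromaticSymm G₁ - chromaticSymm G₂ + chromaticSymm G₃)
    (hG₁ : componentPartition (leafGraph G₁) = componentPartition (leafGraph G) ∧
        deepProd G₁ = a₁ ∨
      ¬ lexLE (componentPartition (leafGraph G₁)) (componentPartition (leafGraph G)) ∧ a₁ = 0)
    (hG₂ : componentPartition (leafGraph G₂) = componentPartition (leafGraph G) ∧
        deepProd G₂ = a₂ ∨
      ¬ lexLE (componentPartition (leafGraph G₂)) (componentPartition (leafGraph G)) ∧ a₂ = 0)
    (hG₃ : ¬ lexLE (componentPartition (leafGraph G₃)) (componentPartition (leafGraph G)))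
    (ha : deepProd G = a₁ - a₂) : HasLeafLeadingTerm G := by
  have key : ∀ {H : SimpleGraph V} {c : (Fintype.card V).Partition → ℚ} {a : ℚ},
      IsLeadingPartition c (componentPartition (leafGraph H)) →
      c (componentPartition (leafGraph H)) = deepProd H →
      (componentPartition (leafGraph H) = componentPartition (leafGraph G) ∧ deepProd H = a ∨
      ¬ lexLE (componentPartition (leafGraph H)) (componentPartition (leafGraph G)) ∧ a = 0) →
      c (componentPartition (leafGraph G)) = a ∧
        ∀ ν, c ν ≠ 0 → lexLE (componentPartition (leafGraph G)) ν := by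
    rintro H c a hc hcH (⟨hH, rfl⟩ | ⟨hH, rfl⟩)
    · exact ⟨hH ▸ hcH, fun ν hν => hH ▸ hc.2 ν hν⟩
    · refine ⟨?_, fun ν hν => lexLE_trans (lexLE_of_not_lexLE hH) (hc.2 ν hν)⟩
      by_contra hne
      exact hH (hc.2 _ hne)
  obtain ⟨c₁, hc₁, hl₁, hv₁⟩ := h₁
  obtain ⟨c₂, hc₂, hl₂, hv₂⟩ := h₂
  obtain ⟨c₃, hc₃, hl₃, hv₃⟩ := h₃
  obtain ⟨e₁, m₁⟩ := key hl₁ hv₁ hG₁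
  obtain ⟨e₂, m₂⟩ := key hl₂ hv₂ hG₂
  obtain ⟨e₃, m₃⟩ := key hl₃ hv₃ (Or.inr ⟨hG₃, rfl⟩)
  have hval : c₁ (componentPartition (leafGraph G)) - c₂ (componentPartition (leafGraph G)) +
      c₃ (componentPartition (leafGraph G)) = deepProd G := by
    rw [e₁, e₂, e₃, ha, add_zero]
  refine ⟨fun μ => c₁ μ - c₂ μ + c₃ μ, ?_, ⟨?_, fun ν hν => ?_⟩, hval⟩
  · rw [hX, hc₁, hc₂, hc₃]
    simp only [add_smul, sub_smul, Finset.sum_add_distrib, Finset.sum_sub_distrib]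
  · exact hval.trans_ne (deepProd_ne_zero G)
  · by_cases n₁ : c₁ ν = 0
    · by_cases n₂ : c₂ ν = 0
      · refine m₃ ν fun n₃ => hν ?_
        change c₁ ν - c₂ ν + c₃ ν = 0
        rw [n₁, n₂, n₃, sub_zero, add_zero]
      · exact m₂ ν n₂
    · exact m₁ ν n₁

/-- The internal edges of `G`, as ordered pairs. -/
def internalPairs (G : SimpleGraph V) : Set (V × V) :=
  {p | G.Adj p.1 p.2 ∧ Branches G p.1 ∧ Branches G p.2}

omit [Fintype V] in
theorem Branches.mono {G H : SimpleGraph V} (h : G ≤ H) {x : V} (hx : Branches G x) :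
    Branches H x := by
  obtain ⟨y, z, hyz, hy, hz⟩ := hx
  exact ⟨y, z, hyz, h hy, h hz⟩

omit [Fintype V] in
theorem internalPairs_mono {G H : SimpleGraph V} (h : G ≤ H) : internalPairs G ⊆ internalPairs H :=
  fun _ hp => ⟨h hp.1, hp.2.1.mono h, hp.2.2.mono h⟩

theorem ncard_internalPairs_lt {G H : SimpleGraph V} {u v : V} (huv : IsPendantEdge G u v)
    (hsub : internalPairs H ⊆ internalPairs G) (hH : (u, v) ∉ internalPairs H) :
    (internalPairs H).ncard < (internalPairs G).ncard :=
  Set.ncard_lt_ncard ⟨hsub, fun hs => hH (hs ⟨huv.adj, huv.branches_left, huv.branches_right⟩)⟩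
    (Set.toFinite _)

namespace IsPendantEdge

variable {G : SimpleGraph V} {u v : V} (h : IsPendantEdge G u v)
include h

theorem ncard_internalPairs_cutEdge :
    (internalPairs (cutEdge G u v)).ncard < (internalPairs G).ncard :=
  ncard_internalPairs_lt h (internalPairs_mono (cutEdge_le G u v)) fun hp =>
    hp.1.2 (Or.inl ⟨rfl, rfl⟩)

theorem ncard_internalPairs_sup_edge :
    (internalPairs (moveNeighbors G u v ⊔ SimpleGraph.edge u v)).ncard <
      (internalPairs G).ncard := by
  refine ncard_internalPairs_lt h ?_ fun hp =>
    h.not_branches_moveNeighbors_left (h.branches_sup_edge_iff.1 hp.2.1)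
  rintro ⟨x, y⟩ ⟨hxy, hx, hy⟩
  change (moveNeighbors G u v ⊔ SimpleGraph.edge u v).Adj x y at hxy
  change Branches _ x at hx
  change Branches _ y at hy
  rw [h.branches_sup_edge_iff] at hx hy
  have hB : ∀ z, Branches (moveNeighbors G u v) z → z ≠ u ∧ Branches G z := fun z hz => by
    have hzu : z ≠ u := fun hzu => h.not_branches_moveNeighbors_left (hzu ▸ hz)
    refine ⟨hzu, ?_⟩
    by_cases hzv : z = v
    · exact hzv ▸ h.branches_right
    · exact (h.branches_moveNeighbors_iff hzu hzv).1 hz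
  obtain ⟨hxu, hx⟩ := hB x hx
  obtain ⟨hyu, hy⟩ := hB y hy
  refine ⟨?_, hx, hy⟩
  rw [SimpleGraph.sup_adj, SimpleGraph.edge_adj] at hxy
  rcases hxy with (hxy | ⟨-, hxy, hxv⟩ | ⟨-, hxy, hxv⟩) | hxy
  · exact hxy.2.2
  · exact absurd hy (h.not_branches hxy hxv)
  · exact absurd hx (h.not_branches hxy hxv)
  · tauto

theorem hasLeafLeadingTerm (h₁ : HasLeafLeadingTerm (cutEdge G u v))
    (h₂ : HasLeafLeadingTerm (moveNeighbors G u v))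
    (h₃ : HasLeafLeadingTerm (moveNeighbors G u v ⊔ SimpleGraph.edge u v)) :
    HasLeafLeadingTerm G := by
  classical
  have hX := chromaticSymm_eq_cutEdge_sub_add h.adj
  by_cases hleaf : ∀ x, G.Adj v x → Branches G x
  · have e₂ := h.componentPartition_moveNeighbors hleaf
    have d₂ := h.deepProd_moveNeighbors hleaf
    have d := h.deepProd_eq_mul hleaf
    by_cases htwo : ∀ a b, a ≠ u → b ≠ u → G.Adj v a → G.Adj v b → a = b
    -- Degree `2`: only the near-contraction contributes, and its sign is the factor `1 - 2`.
    · refine h₁.combine h₂ h₃ hX (Or.inr ⟨h.not_lexLE_cutEdge hleaf htwo, rfl⟩) (Or.inl ⟨e₂, rfl⟩)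
        h.not_lexLE_sup_edge ?_
      obtain ⟨w, hwu, hvw⟩ := h.exists_right
      have hN : G.neighborSet v = {u, w} := by
        ext y
        simp only [SimpleGraph.mem_neighborSet, Set.mem_insert_iff, Set.mem_singleton_iff]
        refine ⟨fun hy => or_iff_not_imp_left.2 fun hyu => htwo y w hyu hwu hy hvw, ?_⟩
        rintro (rfl | rfl)
        · exact h.adj.symm
        · exact hvw
      rw [d, d₂, hN, Set.ncard_pair hwu.symm]
      push_cast
      ring
    · push Not at htwo
      obtain ⟨a, b, hau, hbu, hva, hvb, hab⟩ := htwo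
      refine h₁.combine h₂ h₃ hX
        (Or.inl ⟨by rw [h.leafGraph_cutEdge (Or.inr ⟨a, b, hab, hau, hbu, hva, hvb⟩)], rfl⟩)
        (Or.inl ⟨e₂, rfl⟩) h.not_lexLE_sup_edge ?_
      rw [d, d₂, h.deepProd_cutEdge_eq_mul hleaf hab hau hbu hva hvb]
      ring
  · push Not at hleaf
    obtain ⟨z, hvz, hz⟩ := hleaf
    refine h₁.combine h₂ h₃ hX (Or.inl ⟨by rw [h.leafGraph_cutEdge (Or.inl ⟨z, hvz, hz⟩)], rfl⟩)
      (Or.inr ⟨h.not_lexLE_moveNeighbors hvz hz, rfl⟩) h.not_lexLE_sup_edge ?_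
    rw [h.deepProd_cutEdge hvz hz, sub_zero]

end IsPendantEdge

theorem IsOneDegenerate.hasLeafLeadingTerm {G : SimpleGraph V} (hG : IsOneDegenerate G) :
    HasLeafLeadingTerm G := by
  induction hn : (internalPairs G).ncard using Nat.strong_induction_on generalizing G with
  | _ n ih =>
  subst hn
  by_cases hB : ∀ x y, G.Adj x y → ¬ (Branches G x ∧ Branches G y)
  · exact hasLeafLeadingTerm_of_not_branches hB
  · push Not at hB
    obtain ⟨x, y, hxy, hx, hy⟩ := hB
    obtain ⟨u, v, h⟩ := hG.exists_isPendantEdge hxy hx hy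
    have hlt := h.ncard_internalPairs_sup_edge
    exact h.hasLeafLeadingTerm
      (ih _ h.ncard_internalPairs_cutEdge (hG.mono (cutEdge_le G u v)) rfl)
      -- `moveNeighbors G u v` is a subgraph of the graph with `uv` put back, and inherits from it
      -- both the bound and degeneracy.
      (ih _ ((Set.ncard_le_ncard (internalPairs_mono le_sup_left)
        (Set.toFinite _)).trans_lt hlt) ((h.isOneDegenerate_sup_edge hG).mono le_sup_left) rfl)
      (ih _ hlt (h.isOneDegenerate_sup_edge hG) rfl)

end LeadingTerm

/-! ### Translation to degrees, leaves and deep vertices -/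

section Bridge

variable {V : Type*} [Fintype V] (F : SimpleGraph V) [DecidableRel F.Adj]

theorem branches_iff_two_le_degree (x : V) : Branches F x ↔ 2 ≤ F.degree x := by
  rw [← SimpleGraph.card_neighborFinset_eq_degree, ← Nat.lt_iff_add_one_le, Finset.one_lt_card]
  simp only [Branches, SimpleGraph.mem_neighborFinset]
  grind

theorem isLeaf_iff_not_branches {x y : V} (hxy : F.Adj x y) : IsLeaf F x ↔ ¬ Branches F x := by
  have : 0 < F.degree x := (F.degree_pos_iff_exists_adj x).2 ⟨y, hxy⟩
  rw [IsLeaf, branches_iff_two_le_degree]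
  omega

theorem deleteEdges_internalEdges : F.deleteEdges (internalEdges F) = leafGraph F := by
  ext x y
  simp only [SimpleGraph.deleteEdges_adj, internalEdges, leafGraph, Set.mem_ofPred_eq,
    SimpleGraph.mem_edgeSet, Sym2.mem_iff, forall_eq_or_imp, forall_eq, branches_iff_two_le_degree]
  tauto

/-- A vertex is deep exactly when every edge at it is internal. -/
theorem deepVertices_eq : deepVertices F = isolatedVertices (leafGraph F) := by
  ext x
  rw [mem_isolatedVertices]
  simp only [deepVertices, Finset.mem_filter, Finset.mem_univ, true_and, IsDeep]
  constructor
  · rintro ⟨hx, hE⟩ y ⟨hxy, hB⟩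
    rw [isLeaf_iff_not_branches F hxy, not_not] at hx
    refine hE s(x, y) ⟨hxy, y, by simp, ?_⟩ (by simp)
    rw [isLeaf_iff_not_branches F hxy.symm]
    tauto
  · intro h
    have hB : ∀ y, F.Adj x y → Branches F x ∧ Branches F y := fun y hxy => by
      by_contra hn
      exact h y ⟨hxy, hn⟩
    constructor
    · intro hx
      obtain ⟨y, hxy⟩ := (F.degree_pos_iff_exists_adj x).1 (by rw [hx]; exact one_pos)
      exact (isLeaf_iff_not_branches F hxy).1 hx (hB y hxy).1
    · rintro e ⟨he, z, hz, hleaf⟩ hxe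
      obtain ⟨y, rfl⟩ := Sym2.mem_iff_exists.1 hxe
      have hxy : F.Adj x y := he
      rcases Sym2.mem_iff.1 hz with rfl | rfl
      · exact (isLeaf_iff_not_branches F hxy).1 hleaf (hB y hxy).1
      · exact (isLeaf_iff_not_branches F hxy.symm).1 hleaf (hB z hxy).2

theorem deepProd_eq : deepProd F =
    (-1) ^ (deepVertices F).card * ∏ u ∈ deepVertices F, ((F.degree u : ℚ) - 1) := by
  rw [deepProd, deepVertices_eq, ← Finset.prod_const, ← Finset.prod_mul_distrib]
  refine Finset.prod_congr rfl fun x _ => ?_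
  rw [Set.ncard_eq_toFinset_card', ← SimpleGraph.neighborFinset_def,
    SimpleGraph.card_neighborFinset_eq_degree]
  ring

end Bridge

theorem mainTheorem1 {V : Type*} [Fintype V] (F : SimpleGraph V) [DecidableRel F.Adj]
    (hF : F.IsAcyclic) :
    ∃ c : (Fintype.card V).Partition → ℚ,
      chromaticSymm F = ∑ μ, c μ • starSymm μ ∧
      (∀ c' : (Fintype.card V).Partition → ℚ,
        chromaticSymm F = ∑ μ, c' μ • starSymm μ → c' = c) ∧
      IsLeadingPartition c (leafComponentPartition F) ∧
      c (leafComponentPartition F) =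
        (-1) ^ (deepVertices F).card * ∏ u ∈ deepVertices F, ((F.degree u : ℚ) - 1) := by
  obtain ⟨c, hc, hlead, hval⟩ := hF.isOneDegenerate.hasLeafLeadingTerm
  rw [leafComponentPartition, deleteEdges_internalEdges, ← deepProd_eq]
  refine ⟨c, hc, fun c' hc' => ?_, hlead, hval⟩
  have hsum : ∑ μ, (c' μ - c μ) • starSymm μ = 0 := by
    simp only [sub_smul, Finset.sum_sub_distrib]
    rw [← hc', ← hc, sub_self]
  have := Fintype.linearIndependent_iff.1 (starSymm_linearIndependent _) _ hsum
  exact funext fun μ => sub_eq_zero.1 (this μ)
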